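/- Let $N,d\ge 1$ and endow $\mathbb R^d$ with the norm $|x|=\sum_{i=1}^d|x_i|$. For $E=\mathbb R^d$ or $(\mathbb R^d)^N$ let $\mathcal P(E)$ be the set of Borel probability measures on $E$ with finite first moment. Let $S_k(x_1,\dots,x_N)=x_k$ be the coordinate process on $(\mathbb R^d)^N$ and $\mathcal F_k=\sigma(S_1,\dots,S_k)$. For a vector $\boldsymbol\mu=(\mu_1,\dots,\mu_N)$ of probability measures on $\mathbb R^d$ with finite first moments and $\varepsilon\ge 0$, let $\mathcal M_\varepsilon(\boldsymbol\mu)$ be the set of $\mathbb Q\in\mathcal P((\mathbb R^d)^N)$ such that $\mathbb Q\circ S_k^{-1}=\mu_k$ for $k=1,\dots,N$ and $$\mathbb E_{\mathbb Q}\big[\big|\mathbb E_{\mathbb Q}[S_{k+1}\,|\,\mathcal F_k]-S_k\big|\big]\le\varepsilon\qquad (k=1,\dots,N-1).$$ For $c:(\mathbb R^d)^N\to\mathbb R$ Lipschitz put $$\mathsf P_\varepsilon(\boldsymbol\mu)=\sup_{\mathbb Q\in\mathcal M_\varepsilon(\boldsymbol\mu)}\mathbb E_{\mathbb Q}[c(S_1,\dots,S_N)]\in[-\infty,\infty],$$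 with $\mathsf P_\varepsilon(\boldsymbol\mu)=-\infty$ if $\mathcal M_\varepsilon(\boldsymbol\mu)=\emptyset$, and $\mathsf P=\mathsf P_0$. Let $\mathcal W$ be the Wasserstein distance of order $1$, i.e. $\mathcal W(\mu,\nu)$ is the infimum of $\int |x-y|\,d\pi(x,y)$ over the couplings $\pi$ of $\mu$ and $\nu$, and let $\mathcal W^{\oplus}(\boldsymbol\mu,\boldsymbol\nu)=\sum_{k=1}^N\mathcal W(\mu_k,\nu_k)$. Fix a Lipschitz $c$ and $\boldsymbol\mu\in\mathcal P(\mathbb R^d)^N$ with $\mathcal M_0(\boldsymbol\mu)\ne\emptyset$. On a probability space let, for each $k=1,\dots,N$, $(X^k_i)_{i\ge 1}$ be an i.i.d. sequence of random variables with law $\mu_k$, and let $\hat{\boldsymbol\mu}^n=(\hat\mu^n_k)_{1\le k\le N}$ with $\hat\mu^n_k=\frac1n\sum_{i=1}^n\delta_{X^k_i}$ for $n\ge1$. Let $(\varepsilon_m)_{m\ge1}\subset(0,\infty)$ converge to $0$. (a) Almost surely, the limit $\lim_{n\to\infty}\mathsf P_{\varepsilon_m}(\hat{\boldsymbol\mu}^n)$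 exists for every $m$, and $$\lim_{m\to\infty}\lim_{n\to\infty}\mathsf P_{\varepsilon_m}(\hat{\boldsymbol\mu}^n)=\mathsf P(\boldsymbol\mu).$$ (b) For every strictly increasing sequence $(\hat n_m)_{m\ge1}$ of positive integers with $\sum_{m\ge1}\mathbb E\big[\mathcal W^{\oplus}(\hat{\boldsymbol\mu}^{\hat n_m},\boldsymbol\mu)\big]/\varepsilon_m<\infty$, almost surely $$\lim_{m\to\infty}\mathsf P_{\varepsilon_m}(\hat{\boldsymbol\mu}^{\hat n_m})=\mathsf P(\boldsymbol\mu).$$ -/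

import Mathlib

open MeasureTheory ProbabilityTheory Filter Topology
open scoped ENNReal NNReal

noncomputable section

namespace MOT

/-- The space `ℝ^d` endowed with the `ℓ₁` norm `|x| = ∑ i, |x i|` (and its Borel σ-field). -/
abbrev State (d : ℕ) : Type := PiLp 1 (fun _ : Fin d => ℝ)

/-- The canonical space `(ℝ^d)^N` of paths. The coordinate process is `S k x = x k`, with the
dates numbered by `Fin N`. -/
abbrev PathSpace (N d : ℕ) : Type := Fin N → State d

/-- Borel probability measures with a finite first moment. -/
def finiteMeanMeasures (E : Type*) [NormedAddCommGroup E] [MeasurableSpace E] :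
    Set (Measure E) :=
  {P | IsProbabilityMeasure P ∧ Integrable (fun x : E => x) P}

/-- Transport plans with marginals `μ k`, `k : Fin N`. -/
def plans {N d : ℕ} (μ : Fin N → Measure (State d)) : Set (Measure (PathSpace N d)) :=
  {P | P ∈ finiteMeanMeasures (PathSpace N d) ∧ ∀ k, P.map (fun x : PathSpace N d => x k) = μ k}

/-- Wasserstein distance of order one: the infimum of `E_P |S₁ - S₂|` over transport plans. -/
def wasserstein {d : ℕ} (μ ν : Measure (State d)) : ℝ≥0∞ :=
  ⨅ P ∈ plans ![μ, ν], ∫⁻ x : PathSpace 2 d, ‖x 0 - x 1‖ₑ ∂P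

/-- The product metric: sum of the Wasserstein distances of the components. -/
def wassersteinSum {N d : ℕ} (μ ν : Fin N → Measure (State d)) : ℝ≥0∞ :=
  ∑ k, wasserstein (μ k) (ν k)

/-- The natural filtration of the coordinate process, `F k = σ(S j, j ≤ k)`. -/
@[reducible] def coordFiltration (N d : ℕ) (k : Fin N) : MeasurableSpace (PathSpace N d) :=
  ⨆ j : Fin N, ⨆ _ : j ≤ k, MeasurableSpace.comap (fun x : PathSpace N d => x j) inferInstance

/-- `P` is an `ε`-approximating martingale measure: `P` has a finite first moment and
`E_P |E_P[S (k+1) | F k] - S k| ≤ ε` for every `k` such that `k` and `k + 1` are dates. -/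
def IsApproxMartingaleMeasure {N d : ℕ} (ε : ℝ) (P : Measure (PathSpace N d)) : Prop :=
  P ∈ finiteMeanMeasures (PathSpace N d) ∧
    ∀ (k : ℕ) (hk : k + 1 < N),
      ∫ x, ‖(P[fun y : PathSpace N d => y ⟨k + 1, hk⟩ |
          coordFiltration N d ⟨k, Nat.lt_of_succ_lt hk⟩]) x
        - x ⟨k, Nat.lt_of_succ_lt hk⟩‖ ∂P ≤ ε

/-- `M_ε(μ)`: the transport plans that are `ε`-approximating martingale measures. -/
def approxMartingalePlans {N d : ℕ} (ε : ℝ) (μ : Fin N → Measure (State d)) :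
    Set (Measure (PathSpace N d)) :=
  {P | P ∈ plans μ ∧ IsApproxMartingaleMeasure ε P}

/-- `P_ε(μ)`: the value of the relaxed martingale optimal transport problem with reward `c`;
it is `-∞` when `M_ε(μ)` is empty. -/
def relaxedMOT {N d : ℕ} (c : PathSpace N d → ℝ) (ε : ℝ) (μ : Fin N → Measure (State d)) : EReal :=
  ⨆ P ∈ approxMartingalePlans ε μ, ((∫ x, c x ∂P : ℝ) : EReal)

/-- The vectors of marginals, with finite first moments, such that `M_ε(μ)` is nonempty. -/
def admissibleMarginals (N d : ℕ) (ε : ℝ) : Set (Fin N → Measure (State d)) :=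
  {μ | (∀ k, μ k ∈ finiteMeanMeasures (State d)) ∧ (approxMartingalePlans ε μ).Nonempty}

/-- The empirical measure `(1/n) ∑ δ_{x i}` of the first `n` points of a sequence (`n ≥ 1`). -/
def empiricalMeasure {d : ℕ} (x : ℕ → State d) (n : ℕ) : Measure (State d) :=
  (n : ℝ≥0∞)⁻¹ • ∑ i ∈ Finset.range n, Measure.dirac (x i)

end MOT

end

namespace MOT

variable {N d : ℕ}

/-! The martingale defect is a supremum of linear functionals: by duality of the `ℓ₁` and `ℓ∞`
norms, `E|E[S (k+1) | F k] - S k| ≤ ε` holds exactly when `E[h · (S (k+1) - S k)] ≤ ε` for all `F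
k`-measurable `h` with entries in `[-1, 1]` (`integral_norm_condExp_sub_le_iff`). Everything about
the relaxed constraint is read off this form.

Stability in the marginals: if a kernel transports `μ j` to `ν` at cost below `δ`, resample the
`j`-th coordinate of a plan by that kernel. A test function of the new path, averaged over the draw,
is a test function of the old one, so the defect grows by at most `δ` and the reward changes by at
most `L δ`. Changing the dates one at a time gives `P_ε(μ) ≤ P_{ε+δ}(ν) + L δ` as soon as the summed
Wasserstein distance is below `δ`. With `p ε = P_ε(μ)` and `δ ≤ ε`, this yields the sandwich `p (ε -
δ) - L δ ≤ P_ε(ν) ≤ p (ε + δ) + L δ` (`relaxedMOT_mem_Icc`).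

Regularity of `p`: mixing plans shows that `p` is concave on `[0, ∞)`, hence continuous at each `ε >
0`; tightness of the plans with given marginals, and closedness of the constraint under weak limits,
give right-continuity at `0`.

For (a), the empirical measures converge almost surely in Wasserstein distance, so the inner limit
is `p (ε m)`, which tends to `p 0`. For (b), summability makes the distance eventually smaller than
`ε m`, and the sandwich with `δ = ε m` squeezes the value between quantities tending to `p 0`. -/

/-! ### Plans, couplings and the Wasserstein distance -/

theorem integrable_eval {P : Measure (PathSpace N d)} (hP : P ∈ finiteMeanMeasures (PathSpace N d))
    (k : Fin N) : Integrable (fun x : PathSpace N d => x k) P :=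
  Integrable.eval (f := fun x : PathSpace N d => x) hP.2 k

theorem mem_finiteMeanMeasures_map {E F : Type*} [NormedAddCommGroup E] [MeasurableSpace E]
    [NormedAddCommGroup F] [MeasurableSpace F] [BorelSpace F] [SecondCountableTopology F]
    {P : Measure E} [IsProbabilityMeasure P] {f : E → F} (hf : Measurable f)
    (hi : Integrable f P) : P.map f ∈ finiteMeanMeasures F :=
  ⟨Measure.isProbabilityMeasure_map hf.aemeasurable,
    (integrable_map_measure (aestronglyMeasurable_id) hf.aemeasurable).2 hi⟩

theorem mem_finiteMeanMeasures_of_map_eval [NeZero N] {P : Measure (PathSpace N d)}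
    (h : ∀ k, P.map (fun x : PathSpace N d => x k) ∈ finiteMeanMeasures (State d)) :
    P ∈ finiteMeanMeasures (PathSpace N d) := by
  have := (h 0).1
  refine ⟨Measure.isProbabilityMeasure_of_map (fun x : PathSpace N d => x 0), ?_⟩
  refine Integrable.of_eval fun k => ?_
  exact (integrable_map_measure aestronglyMeasurable_id (measurable_pi_apply k).aemeasurable).1
    (h k).2

theorem mem_finiteMeanMeasures_of_mem_plans {μ : Fin N → Measure (State d)}
    {P : Measure (PathSpace N d)} (hP : P ∈ plans μ) (k : Fin N) :
    μ k ∈ finiteMeanMeasures (State d) := by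
  have := hP.1.1
  rw [← hP.2 k]
  exact mem_finiteMeanMeasures_map (measurable_pi_apply k) (integrable_eval hP.1 k)

/-- The cost of any coupling bounds the Wasserstein distance. -/
theorem wasserstein_le_of_coupling {μ ν : Measure (State d)} (hμ : μ ∈ finiteMeanMeasures (State d))
    (hν : ν ∈ finiteMeanMeasures (State d)) {ρ : Measure (State d × State d)}
    (h₁ : ρ.map Prod.fst = μ) (h₂ : ρ.map Prod.snd = ν) :
    wasserstein μ ν ≤ ∫⁻ p, ‖p.1 - p.2‖ₑ ∂ρ := by
  have hm : Measurable (fun p : State d × State d => (![p.1, p.2] : PathSpace 2 d)) := by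
    refine measurable_pi_iff.2 fun k => ?_
    fin_cases k
    · exact measurable_fst
    · exact measurable_snd
  have hmarg : ∀ k, (ρ.map (fun p : State d × State d => (![p.1, p.2] : PathSpace 2 d))).map
      (fun x : PathSpace 2 d => x k) = ![μ, ν] k := by
    intro k
    rw [Measure.map_map (measurable_pi_apply k) hm]
    fin_cases k
    · exact h₁
    · exact h₂
  have hplan : ρ.map (fun p : State d × State d => (![p.1, p.2] : PathSpace 2 d)) ∈
      plans ![μ, ν] := by
    refine ⟨mem_finiteMeanMeasures_of_map_eval fun k => ?_, hmarg⟩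
    rw [hmarg]
    fin_cases k
    · exact hμ
    · exact hν
  refine (iInf₂_le _ hplan).trans ?_
  rw [lintegral_map (by fun_prop) hm]
  simp

/-- A transport of cost less than `r` is realised by a Markov kernel. -/
theorem exists_kernel_of_wasserstein_lt {μ ν : Measure (State d)} {r : ℝ≥0∞}
    (h : wasserstein μ ν < r) :
    μ ∈ finiteMeanMeasures (State d) ∧ ν ∈ finiteMeanMeasures (State d) ∧
    ∃ κ : Kernel (State d) (State d), IsMarkovKernel κ ∧ κ ∘ₘ μ = ν ∧
      ∫⁻ p, ‖p.1 - p.2‖ₑ ∂(μ ⊗ₘ κ) < r := by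
  obtain ⟨P, hP⟩ := iInf_lt_iff.1 h
  obtain ⟨hP, hr⟩ := iInf_lt_iff.1 hP
  have hμ := mem_finiteMeanMeasures_of_mem_plans hP 0
  have hν := mem_finiteMeanMeasures_of_mem_plans hP 1
  refine ⟨hμ, hν, ?_⟩
  have := hP.1.1
  have hm : Measurable (fun x : PathSpace 2 d => (x 0, x 1)) := by fun_prop
  set ρ := P.map (fun x : PathSpace 2 d => (x 0, x 1)) with hρ
  have : IsProbabilityMeasure ρ := Measure.isProbabilityMeasure_map hm.aemeasurable
  have h1 : ρ.fst = μ := by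
    rw [Measure.fst, hρ, Measure.map_map measurable_fst hm]
    exact hP.2 0
  have h2 : ρ.snd = ν := by
    rw [Measure.snd, hρ, Measure.map_map measurable_snd hm]
    exact hP.2 1
  have h3 : μ ⊗ₘ ρ.condKernel = ρ := by
    rw [← h1]; exact ρ.disintegrate ρ.condKernel
  have : IsProbabilityMeasure μ := hμ.1
  refine ⟨ρ.condKernel, inferInstance, ?_, ?_⟩
  · rw [← Measure.snd_compProd, h3, h2]
  · rw [h3, hρ, lintegral_map (by fun_prop) hm]
    exact hr

theorem wasserstein_le_of_kernel {μ : Measure (State d)} (hμ : μ ∈ finiteMeanMeasures (State d))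
    (κ : Kernel (State d) (State d)) [IsMarkovKernel κ]
    (hκ : κ ∘ₘ μ ∈ finiteMeanMeasures (State d)) :
    wasserstein μ (κ ∘ₘ μ) ≤ ∫⁻ p, ‖p.1 - p.2‖ₑ ∂(μ ⊗ₘ κ) := by
  have := hμ.1
  refine wasserstein_le_of_coupling hμ hκ ?_ ?_
  · exact Measure.fst_compProd μ κ
  · exact Measure.snd_compProd μ κ

theorem wasserstein_comm_le (μ ν : Measure (State d)) : wasserstein μ ν ≤ wasserstein ν μ := by
  refine le_of_forall_gt fun r hr => ?_
  obtain ⟨hν, hμ, κ, hκ, rfl, hκr⟩ := exists_kernel_of_wasserstein_lt hr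
  have := hν.1
  refine (wasserstein_le_of_coupling (ρ := (ν ⊗ₘ κ).map Prod.swap) hμ hν ?_ ?_).trans_lt ?_
  · rw [Measure.map_map measurable_fst measurable_swap]
    exact Measure.snd_compProd ν κ
  · rw [Measure.map_map measurable_snd measurable_swap]
    exact Measure.fst_compProd ν κ
  · rw [lintegral_map (by fun_prop) measurable_swap]
    refine lt_of_eq_of_lt (lintegral_congr fun p => ?_) hκr
    exact enorm_sub_rev _ _

theorem wasserstein_comm (μ ν : Measure (State d)) : wasserstein μ ν = wasserstein ν μ :=
  le_antisymm (wasserstein_comm_le μ ν) (wasserstein_comm_le ν μ)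

/-- Gluing by composition: near-optimal kernels from `μ` to `ν` and from `ν` to `ξ` compose to a
kernel from `μ` to `ξ`. Strict bounds `r`, `s` stand in for optimal plans, so attainment of the
infimum is not needed. -/
theorem wasserstein_triangle (μ ν ξ : Measure (State d)) :
    wasserstein μ ξ ≤ wasserstein μ ν + wasserstein ν ξ := by
  by_contra! hlt
  obtain ⟨r, s, hr, hs, hrs⟩ : ∃ r s, wasserstein μ ν < r ∧ wasserstein ν ξ < s ∧
      r + s < wasserstein μ ξ := by
    have h₁ : wasserstein μ ν ≠ ∞ := fun h => by simp [h] at hlt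
    have h₂ : wasserstein ν ξ ≠ ∞ := fun h => by simp [h] at hlt
    obtain ⟨t, ht, htlt⟩ := ENNReal.lt_iff_exists_add_pos_lt.1 hlt
    refine ⟨wasserstein μ ν + t / 2, wasserstein ν ξ + t / 2,
      ENNReal.lt_add_right h₁ (by simpa using ht.ne'),
      ENNReal.lt_add_right h₂ (by simpa using ht.ne'), ?_⟩
    rwa [add_add_add_comm, ENNReal.add_halves]
  obtain ⟨hμ, hν, κ, hκ, hκν, hκr⟩ := exists_kernel_of_wasserstein_lt hr
  obtain ⟨-, hξ, η, hη, hηξ, hηs⟩ := exists_kernel_of_wasserstein_lt hs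
  have := hμ.1
  have := hν.1
  refine (lt_self_iff_false (wasserstein μ ξ)).1 (lt_of_le_of_lt ?_ hrs)
  have hcomp : (η ∘ₖ κ) ∘ₘ μ = ξ := by rw [← Measure.comp_assoc, hκν, hηξ]
  have hle := wasserstein_le_of_kernel hμ (η ∘ₖ κ) (hcomp ▸ hξ)
  rw [hcomp] at hle
  refine hle.trans (le_trans ?_ (add_le_add hκr.le hηs.le))
  rw [Measure.lintegral_compProd (by fun_prop), Measure.lintegral_compProd (by fun_prop),
    Measure.lintegral_compProd (by fun_prop), ← hκν,
    Measure.lintegral_bind κ.measurable.aemeasurable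
      (Measurable.lintegral_kernel_prod_right' (f := fun p : State d × State d => ‖p.1 - p.2‖ₑ)
        (by fun_prop)).aemeasurable,
    ← lintegral_add_left (Measurable.lintegral_kernel_prod_right'
      (f := fun p : State d × State d => ‖p.1 - p.2‖ₑ) (by fun_prop))]
  refine lintegral_mono fun x => ?_
  rw [Kernel.lintegral_comp _ _ _ (by fun_prop), ← lintegral_add_left (by fun_prop)]
  refine lintegral_mono fun y => ?_
  have : ‖x - y‖ₑ = ∫⁻ _, ‖x - y‖ₑ ∂(η y) := by simp
  simp only
  rw [this, ← lintegral_add_left (by fun_prop)]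
  refine lintegral_mono fun z => ?_
  have := enorm_add_le (x - y) (y - z)
  simpa using this

theorem wassersteinSum_comm (μ ν : Fin N → Measure (State d)) :
    wassersteinSum μ ν = wassersteinSum ν μ :=
  Finset.sum_congr rfl fun _ _ => wasserstein_comm _ _

/-! ### The coordinate filtration and the dual form of the martingale defect -/

/-- Stop observing a path after the date `k`. -/
def trunc (k : Fin N) (x : PathSpace N d) : PathSpace N d := fun i => if i ≤ k then x i else 0

theorem continuous_trunc (k : Fin N) : Continuous (trunc (d := d) k) := by
  refine continuous_pi fun i => ?_
  by_cases h : i ≤ k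
  · simpa [trunc, h] using continuous_apply i
  · simpa [trunc, h] using continuous_const

theorem measurable_trunc (k : Fin N) : Measurable (trunc (d := d) k) :=
  (continuous_trunc k).measurable

theorem trunc_trunc (k : Fin N) (x : PathSpace N d) : trunc k (trunc k x) = trunc k x := by
  funext i
  by_cases h : i ≤ k <;> simp [trunc, h]

theorem trunc_update_of_le {j k : Fin N} (h : j ≤ k) (x : PathSpace N d) (y : State d) :
    trunc k (Function.update x j y) = Function.update (trunc k x) j y := by
  funext i
  by_cases hi : i = j
  · subst hi; simp [trunc, h]
  · simp [trunc, hi]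

theorem trunc_update_of_not_le {j k : Fin N} (h : ¬ j ≤ k) (x : PathSpace N d) (y : State d) :
    trunc k (Function.update x j y) = trunc k x := by
  funext i
  by_cases hi : i = j
  · subst hi; simp [trunc, h]
  · simp [trunc, hi]

theorem coordFiltration_eq_comap_trunc (k : Fin N) :
    coordFiltration N d k = MeasurableSpace.comap (trunc k) inferInstance := by
  apply le_antisymm
  · refine iSup₂_le fun j hj => ?_
    have : (fun x : PathSpace N d => x j) = (fun x : PathSpace N d => x j) ∘ trunc k := by
      funext x; simp [trunc, hj]
    rw [this, ← MeasurableSpace.comap_comp]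
    exact MeasurableSpace.comap_mono (measurable_pi_apply j).comap_le
  · refine Measurable.comap_le
      (@measurable_pi_lambda _ _ _ (coordFiltration N d k) _ _ fun i => ?_)
    by_cases h : i ≤ k
    · have : (fun x : PathSpace N d => trunc k x i) = fun x => x i := by
        funext x; simp [trunc, h]
      rw [this]
      exact Measurable.mono (comap_measurable _)
        (le_iSup₂_of_le (f := fun (j : Fin N) (_ : j ≤ k) =>
          MeasurableSpace.comap (fun x : PathSpace N d => x j) inferInstance) i h le_rfl) le_rfl
    · simp only [trunc, h, if_false]
      exact measurable_const

theorem coordFiltration_le (k : Fin N) :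
    coordFiltration N d k ≤ (inferInstance : MeasurableSpace (PathSpace N d)) := by
  rw [coordFiltration_eq_comap_trunc]
  exact (measurable_trunc k).comap_le

/-- `F k` is generated by the single idempotent map `trunc k`, so adaptedness becomes a pointwise
invariance that can be checked by computation. -/
theorem measurable_coordFiltration_iff {E : Type*} [MeasurableSpace E] [MeasurableSingletonClass E]
    {k : Fin N} {f : PathSpace N d → E} :
    Measurable[coordFiltration N d k] f ↔ Measurable f ∧ ∀ x, f (trunc k x) = f x := by
  constructor
  · intro h
    refine ⟨h.mono (coordFiltration_le k) le_rfl, fun x => ?_⟩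
    rw [coordFiltration_eq_comap_trunc] at h
    exact h.factorsThrough (trunc_trunc k x)
  · rintro ⟨h, hk⟩
    have : f = f ∘ trunc k := funext fun x => (hk x).symm
    rw [this, coordFiltration_eq_comap_trunc]
    exact h.comp (comap_measurable _)

/-- Functions of the path up to date `k`, with values in the unit ball of the dual `ℓ∞`. -/
structure IsTestFunction (k : Fin N) (h : PathSpace N d → Fin d → ℝ) : Prop where
  measurable : Measurable h
  trunc_eq : ∀ x, h (trunc k x) = h x
  abs_le_one : ∀ x i, |h x i| ≤ 1

theorem integrable_coord {P : Measure (PathSpace N d)} (hP : P ∈ finiteMeanMeasures (PathSpace N d))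
    (k : Fin N) (i : Fin d) : Integrable (fun x : PathSpace N d => x k i) P :=
  (PiLp.proj (𝕜 := ℝ) 1 (fun _ : Fin d => ℝ) i).integrable_comp (integrable_eval hP k)

theorem IsTestFunction.measurable_apply {k : Fin N} {h : PathSpace N d → Fin d → ℝ}
    (hh : IsTestFunction k h) (i : Fin d) : Measurable fun x => h x i :=
  (measurable_pi_apply i).comp hh.measurable

theorem IsTestFunction.integrable_mul {k : Fin N} {h : PathSpace N d → Fin d → ℝ}
    (hh : IsTestFunction k h) {P : Measure (PathSpace N d)} {f : PathSpace N d → ℝ}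
    (hf : Integrable f P) (i : Fin d) : Integrable (fun x => h x i * f x) P :=
  hf.bdd_mul (c := 1) (hh.measurable_apply i).aestronglyMeasurable
    (ae_of_all _ fun x => by simpa using hh.abs_le_one x i)

theorem IsTestFunction.integrable_sum {j k l : Fin N} {h : PathSpace N d → Fin d → ℝ}
    (hh : IsTestFunction l h) {P : Measure (PathSpace N d)}
    (hP : P ∈ finiteMeanMeasures (PathSpace N d)) :
    Integrable (fun x => ∑ i, h x i * (x j i - x k i)) P :=
  integrable_finsetSum _ fun i _ =>
    hh.integrable_mul ((integrable_coord hP j i).sub (integrable_coord hP k i)) i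

theorem integral_testFunction_mul_condExp {P : Measure (PathSpace N d)}
    (hP : P ∈ finiteMeanMeasures (PathSpace N d)) (j k : Fin N) {h : PathSpace N d → Fin d → ℝ}
    (hh : IsTestFunction k h) (i : Fin d) :
    ∫ x, h x i * x j i ∂P =
      ∫ x, h x i * (P[fun y : PathSpace N d => y j | coordFiltration N d k]) x i ∂P := by
  have := hP.1
  have hm := coordFiltration_le (N := N) (d := d) k
  have hsm : StronglyMeasurable[coordFiltration N d k] fun x => h x i := by
    refine Measurable.stronglyMeasurable (measurable_coordFiltration_iff.2
      ⟨hh.measurable_apply i, fun x => by rw [hh.trunc_eq]⟩)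
  rw [← integral_condExp hm]
  refine integral_congr_ae ?_
  have h1 := condExp_mul_of_stronglyMeasurable_left hsm
    (hh.integrable_mul (integrable_coord hP j i) i) (integrable_coord hP j i)
  have h2 := (PiLp.proj (𝕜 := ℝ) 1 (fun _ : Fin d => ℝ) i).comp_condExp_comm
    (m := coordFiltration N d k) (integrable_eval hP j)
  filter_upwards [h1, h2] with x h1 h2
  refine h1.trans ?_
  simp only [Pi.mul_apply]
  congr 1
  exact h2.symm

theorem integral_testFunction_eq {P : Measure (PathSpace N d)}
    (hP : P ∈ finiteMeanMeasures (PathSpace N d)) (j k : Fin N) {h : PathSpace N d → Fin d → ℝ}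
    (hh : IsTestFunction k h) :
    ∫ x, ∑ i, h x i * (x j i - x k i) ∂P =
      ∫ x, ∑ i, h x i *
        ((P[fun y : PathSpace N d => y j | coordFiltration N d k]) x - x k) i ∂P := by
  have hC (i : Fin d) : Integrable (fun x =>
      (P[fun y : PathSpace N d => y j | coordFiltration N d k]) x i) P :=
    (PiLp.proj (𝕜 := ℝ) 1 (fun _ : Fin d => ℝ) i).integrable_comp integrable_condExp
  have hS (l : Fin N) (i : Fin d) := integrable_coord hP l i
  have h1 (i : Fin d) : Integrable (fun x : PathSpace N d => h x i * (x j i - x k i)) P :=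
    hh.integrable_mul ((hS j i).sub (hS k i)) i
  have h2 (i : Fin d) : Integrable (fun x : PathSpace N d => h x i *
      ((P[fun y : PathSpace N d => y j | coordFiltration N d k]) x - x k) i) P :=
    hh.integrable_mul ((hC i).sub (hS k i)) i
  rw [integral_finsetSum _ fun i _ => h1 i, integral_finsetSum _ fun i _ => h2 i]
  refine Finset.sum_congr rfl fun i _ => ?_
  simp only [PiLp.sub_apply, mul_sub]
  rw [integral_sub (hh.integrable_mul (hS j i) i) (hh.integrable_mul (hS k i) i),
    integral_sub (hh.integrable_mul (hC i) i) (hh.integrable_mul (hS k i) i),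
    integral_testFunction_mul_condExp hP j k hh i]

/-- Dual formulation of the relaxed martingale constraint. -/
theorem integral_norm_condExp_sub_le_iff {P : Measure (PathSpace N d)}
    (hP : P ∈ finiteMeanMeasures (PathSpace N d)) (j k : Fin N) (ε : ℝ) :
    ∫ x, ‖(P[fun y : PathSpace N d => y j | coordFiltration N d k]) x - x k‖ ∂P ≤ ε ↔
      ∀ h : PathSpace N d → Fin d → ℝ, IsTestFunction k h →
        ∫ x, ∑ i, h x i * (x j i - x k i) ∂P ≤ ε := by
  have hint : Integrable (fun x =>
      (P[fun y : PathSpace N d => y j | coordFiltration N d k]) x - x k) P :=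
    integrable_condExp.sub (integrable_eval hP k)
  have hC (i : Fin d) : Integrable (fun x =>
      ((P[fun y : PathSpace N d => y j | coordFiltration N d k]) x - x k) i) P :=
    (PiLp.proj (𝕜 := ℝ) 1 (fun _ : Fin d => ℝ) i).integrable_comp hint
  constructor
  · intro hε h hh
    rw [integral_testFunction_eq hP j k hh]
    refine (integral_mono (integrable_finsetSum _ fun i _ => hh.integrable_mul (hC i) i)
      hint.norm fun x => ?_).trans hε
    simp only
    rw [PiLp.norm_eq_of_L1]
    refine Finset.sum_le_sum fun i _ => (le_abs_self _).trans ?_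
    rw [abs_mul, Real.norm_eq_abs]
    exact mul_le_of_le_one_left (abs_nonneg _) (hh.abs_le_one x i)
  · intro H
    set D : PathSpace N d → State d := fun x =>
      (P[fun y : PathSpace N d => y j | coordFiltration N d k]) x - x k with hD
    have hDm : Measurable[coordFiltration N d k] D := by
      refine Measurable.sub stronglyMeasurable_condExp.measurable
        (measurable_coordFiltration_iff.2 ⟨measurable_pi_apply k, fun x => by simp [trunc]⟩)
    obtain ⟨hDm, hDk⟩ := measurable_coordFiltration_iff.1 hDm
    -- The supremum is attained at the coordinatewise sign of the drift `D`, which is adapted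
    -- because `D` is.
    have hh : IsTestFunction k fun x i => if 0 ≤ D x i then (1 : ℝ) else -1 := by
      refine ⟨measurable_pi_iff.2 fun i => ?_, fun x => by simp only [hDk], fun x i => ?_⟩
      · exact Measurable.ite (measurableSet_le measurable_const (by fun_prop))
          measurable_const measurable_const
      · by_cases h0 : 0 ≤ D x i <;> simp [h0]
    refine le_trans (le_of_eq ?_) (H _ hh)
    rw [integral_testFunction_eq hP j k hh]
    refine integral_congr_ae (ae_of_all _ fun x => ?_)
    change ‖D x‖ = ∑ i, (if 0 ≤ D x i then (1 : ℝ) else -1) * D x i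
    rw [PiLp.norm_eq_of_L1]
    refine Finset.sum_congr rfl fun i _ => ?_
    by_cases h0 : 0 ≤ D x i
    · simp [h0, abs_of_nonneg]
    · simp [h0, abs_of_neg (not_le.1 h0)]

/-! ### Resampling one coordinate of a plan -/

/-- The joint law of a path and of a resampling of its `j`-th coordinate by the kernel `κ`. -/
noncomputable def resample (P : Measure (PathSpace N d)) (j : Fin N)
    (κ : Kernel (State d) (State d)) : Measure (PathSpace N d × State d) :=
  P ⊗ₘ κ.comap (fun x : PathSpace N d => x j) (measurable_pi_apply j)

/-- Replace the `j`-th coordinate of a path. -/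
def replace (j : Fin N) (p : PathSpace N d × State d) : PathSpace N d := Function.update p.1 j p.2

theorem measurable_replace (j : Fin N) : Measurable (replace (d := d) j) := by
  refine measurable_pi_iff.2 fun i => ?_
  by_cases h : i = j
  · subst h; simpa [replace] using measurable_snd
  · simp only [replace, Function.update_of_ne h]
    fun_prop

instance {P : Measure (PathSpace N d)} [IsProbabilityMeasure P] {j : Fin N}
    {κ : Kernel (State d) (State d)} [IsMarkovKernel κ] : IsProbabilityMeasure (resample P j κ) := by
  unfold resample; infer_instance

section

variable {P : Measure (PathSpace N d)} [IsProbabilityMeasure P] (j : Fin N)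
  (κ : Kernel (State d) (State d)) [IsMarkovKernel κ]

theorem resample_map_fst : (resample P j κ).map Prod.fst = P := Measure.fst_compProd P _

theorem resample_map_pair :
    (resample P j κ).map (fun p => (p.1 j, p.2)) = P.map (fun x : PathSpace N d => x j) ⊗ₘ κ := by
  have hm : Measurable (fun p : PathSpace N d × State d => (p.1 j, p.2)) := by fun_prop
  have : IsProbabilityMeasure (P.map (fun x : PathSpace N d => x j)) :=
    Measure.isProbabilityMeasure_map (measurable_pi_apply j).aemeasurable
  refine Measure.ext_of_lintegral _ fun f hf => ?_
  rw [lintegral_map hf hm, resample, Measure.lintegral_compProd (by fun_prop),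
    Measure.lintegral_compProd hf,
    lintegral_map (Measurable.lintegral_kernel_prod_right' hf) (measurable_pi_apply j)]
  rfl

theorem resample_map_snd :
    (resample P j κ).map Prod.snd = κ ∘ₘ P.map (fun x : PathSpace N d => x j) := by
  have : IsProbabilityMeasure (P.map (fun x : PathSpace N d => x j)) :=
    Measure.isProbabilityMeasure_map (measurable_pi_apply j).aemeasurable
  rw [← Measure.snd_compProd, ← resample_map_pair, Measure.snd,
    Measure.map_map measurable_snd (by fun_prop)]
  rfl

theorem resample_replace_eval (k : Fin N) :
    ((resample P j κ).map (replace j)).map (fun x : PathSpace N d => x k) =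
      Function.update (fun k => P.map (fun x : PathSpace N d => x k)) j
        (κ ∘ₘ P.map (fun x : PathSpace N d => x j)) k := by
  rw [Measure.map_map (measurable_pi_apply k) (measurable_replace j)]
  by_cases h : k = j
  · subst h
    rw [Function.update_self, ← resample_map_snd]
    congr 1
    funext p
    simp [replace]
  · rw [Function.update_of_ne h]
    conv_rhs => rw [← resample_map_fst (P := P) j κ]
    rw [Measure.map_map (measurable_pi_apply k) measurable_fst]
    congr 1
    funext p
    simp [replace, h]

end

theorem sum_mul_le_norm {a : Fin d → ℝ} (ha : ∀ i, |a i| ≤ 1) (v : State d) :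
    ∑ i, a i * v i ≤ ‖v‖ := by
  rw [PiLp.norm_eq_of_L1]
  refine Finset.sum_le_sum fun i _ => (le_abs_self _).trans ?_
  rw [abs_mul, Real.norm_eq_abs]
  exact mul_le_of_le_one_left (abs_nonneg _) (ha i)

theorem norm_replace_sub_le (j k l : Fin N) (p : PathSpace N d × State d) :
    ‖(replace j p l - replace j p k) - (p.1 l - p.1 k)‖ ≤ ‖p.1 j - p.2‖ := by
  by_cases hl : l = j <;> by_cases hk : k = j
  · subst hl hk; simp
  · subst hl; simp [replace, hk, norm_sub_rev]
  · subst hk; simp [replace, hl]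
  · simp [replace, hk, hl]

/-- Given the old path, the law of the draw depends on `x j` alone. If `j ≤ k`, then `x j` is
already observed at date `k`, so the average is still adapted; otherwise `h` does not see the
modified coordinate at all. -/
theorem IsTestFunction.average {j k : Fin N} {h : PathSpace N d → Fin d → ℝ}
    (hh : IsTestFunction k h) (κ : Kernel (State d) (State d)) [IsMarkovKernel κ] :
    IsTestFunction k fun x i => ∫ y, h (replace j (x, y)) i ∂(κ (x j)) := by
  refine ⟨measurable_pi_iff.2 fun i => ?_, fun x => ?_, fun x i => ?_⟩
  · exact (StronglyMeasurable.integral_kernel_prod_right'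
      (κ := κ.comap (fun x : PathSpace N d => x j) (measurable_pi_apply j))
      (f := fun p => h (replace j p) i)
      ((hh.measurable_apply i).comp (measurable_replace j)).stronglyMeasurable).measurable
  · funext i
    by_cases hjk : j ≤ k
    · have h1 : trunc k x j = x j := by simp [trunc, hjk]
      rw [h1]
      refine integral_congr_ae (ae_of_all _ fun y => ?_)
      simp only [replace]
      rw [← trunc_update_of_le hjk, hh.trunc_eq]
    · have h1 (x : PathSpace N d) (y : State d) : h (replace j (x, y)) = h x := by
        rw [replace, ← hh.trunc_eq, trunc_update_of_not_le hjk, hh.trunc_eq]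
      simp [h1, hh.trunc_eq]
  · have := norm_integral_le_of_norm_le_const (μ := κ (x j)) (C := 1)
      (f := fun y => h (replace j (x, y)) i) (ae_of_all _ fun y => hh.abs_le_one _ i)
    simpa using this

theorem integrable_of_lipschitzWith {E : Type*} [NormedAddCommGroup E] [MeasurableSpace E]
    [BorelSpace E] {P : Measure E} (hP : P ∈ finiteMeanMeasures E) {c : E → ℝ} {L : ℝ≥0}
    (hc : LipschitzWith L c) : Integrable c P := by
  have := hP.1
  refine ((integrable_const |c 0|).add (hP.2.norm.const_mul (L : ℝ))).mono'
    hc.continuous.measurable.aestronglyMeasurable (ae_of_all _ fun x => ?_)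
  have := hc.dist_le_mul x 0
  rw [dist_zero_right, Real.dist_eq] at this
  have h2 := abs_add_le (c x - c 0) (c 0)
  rw [sub_add_cancel] at h2
  rw [Real.norm_eq_abs]
  simp only [Pi.add_apply]
  linarith

/-- Resampling one coordinate at a cost `δ` relaxes the martingale constraint by `δ`. -/
theorem integral_testFunction_resample_le {P : Measure (PathSpace N d)}
    (hP : P ∈ finiteMeanMeasures (PathSpace N d)) {j k l : Fin N}
    (κ : Kernel (State d) (State d)) [IsMarkovKernel κ] {ε : ℝ}
    (H : ∀ h : PathSpace N d → Fin d → ℝ, IsTestFunction k h →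
      ∫ x, ∑ i, h x i * (x l i - x k i) ∂P ≤ ε)
    (hP' : (resample P j κ).map (replace j) ∈ finiteMeanMeasures (PathSpace N d))
    (hint : Integrable (fun p => ‖p.1 j - p.2‖) (resample P j κ))
    {h : PathSpace N d → Fin d → ℝ} (hh : IsTestFunction k h) :
    ∫ x, ∑ i, h x i * (x l i - x k i) ∂((resample P j κ).map (replace j)) ≤
      ε + ∫ p, ‖p.1 j - p.2‖ ∂(resample P j κ) := by
  have := hP.1
  have hmr := measurable_replace (d := d) j
  have hI := (integrable_map_measure (hh.integrable_sum (j := l) (k := k) hP').1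
    hmr.aemeasurable).1 (hh.integrable_sum (j := l) (k := k) hP')
  have hcoord (m : Fin N) (i : Fin d) : Integrable (fun p : PathSpace N d × State d => p.1 m i)
      (resample P j κ) := by
    have := integrable_coord hP m i
    rw [← resample_map_fst (P := P) j κ] at this
    exact (integrable_map_measure this.1 measurable_fst.aemeasurable).1 this
  have hJ : Integrable (fun p : PathSpace N d × State d =>
      ∑ i, h (replace j p) i * (p.1 l i - p.1 k i)) (resample P j κ) := by
    refine integrable_finsetSum _ fun i _ => ?_
    exact ((hcoord l i).sub (hcoord k i)).bdd_mul (c := 1)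
      ((hh.measurable_apply i).comp hmr).aestronglyMeasurable
      (ae_of_all _ fun p => by simpa using hh.abs_le_one _ i)
  rw [integral_map hmr.aemeasurable (hh.integrable_sum (j := l) (k := k) hP').1]
  calc ∫ p, ∑ i, h (replace j p) i * (replace j p l i - replace j p k i) ∂(resample P j κ)
      ≤ ∫ p, (∑ i, h (replace j p) i * (p.1 l i - p.1 k i)) + ‖p.1 j - p.2‖
          ∂(resample P j κ) := by
        -- Replacing the increment of the new path by that of the old one costs at most the
        -- displacement, since `h` lies in the dual unit ball.
        refine integral_mono hI (hJ.add hint) fun p => ?_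
        have h1 := sum_mul_le_norm (hh.abs_le_one (replace j p))
          ((replace j p l - replace j p k) - (p.1 l - p.1 k))
        have h2 := norm_replace_sub_le j k l p
        simp only [PiLp.sub_apply, mul_sub, Finset.sum_sub_distrib] at h1 ⊢
        linarith
    _ = (∫ p, ∑ i, h (replace j p) i * (p.1 l i - p.1 k i) ∂(resample P j κ)) +
          ∫ p, ‖p.1 j - p.2‖ ∂(resample P j κ) := integral_add hJ hint
    _ ≤ _ := by
        gcongr
        -- The old increment does not involve the draw, so integrating the draw out first leaves the
        -- averaged test function.
        refine le_trans (le_of_eq ?_) (H _ (hh.average (j := j) κ))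
        rw [resample, Measure.integral_compProd hJ]
        refine integral_congr_ae (ae_of_all _ fun x => ?_)
        simp only [Kernel.comap_apply]
        rw [integral_finsetSum]
        · refine Finset.sum_congr rfl fun i _ => ?_
          rw [integral_mul_const]
        · intro i _
          refine Integrable.mul_const ?_ _
          refine Integrable.of_bound (C := 1) ?_ (ae_of_all _ fun y => ?_)
          · exact (((hh.measurable_apply i).comp hmr).comp
              measurable_prodMk_left).aestronglyMeasurable
          · simpa using hh.abs_le_one _ i

/-! ### Stability of the value in the marginals -/

theorem relaxedMOT_mono (c : PathSpace N d → ℝ) (μ : Fin N → Measure (State d)) :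
    Monotone fun ε => relaxedMOT c ε μ := by
  intro ε ε' h
  refine biSup_mono fun P hP => ⟨hP.1, hP.2.1, fun k hk => (hP.2.2 k hk).trans h⟩

/-- Each plan for `μ`, once its `j`-th coordinate is resampled, competes in the problem for the
updated marginals with relaxation `ε + δ`. -/
theorem relaxedMOT_le_update {c : PathSpace N d → ℝ} {L : ℝ≥0} (hc : LipschitzWith L c) (ε : ℝ)
    {δ : ℝ} (μ : Fin N → Measure (State d)) (j : Fin N) {ν : Measure (State d)}
    (hW : wasserstein (μ j) ν < ENNReal.ofReal δ) :
    relaxedMOT c ε μ ≤ relaxedMOT c (ε + δ) (Function.update μ j ν) + ((L * δ : ℝ) : EReal) := by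
  have hN : NeZero N := ⟨fun h => by subst h; exact j.elim0⟩
  obtain ⟨-, hν, κ, hκ, rfl, hcost⟩ := exists_kernel_of_wasserstein_lt hW
  have hδ : 0 < δ := ENNReal.ofReal_pos.1 (bot_le.trans_lt hcost)
  refine iSup₂_le fun P hP => ?_
  have hPm := hP.1.1
  have := hPm.1
  have hmr := measurable_replace (d := d) j
  set P' := (resample P j κ).map (replace j) with hP'def
  have hmarg : ∀ k, P'.map (fun x : PathSpace N d => x k) =
      Function.update μ j (κ ∘ₘ μ j) k := by
    intro k
    have h1 : (fun k => P.map (fun x : PathSpace N d => x k)) = μ := funext hP.1.2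
    rw [hP'def, resample_replace_eval, h1, hP.1.2 j]
  have hP' : P' ∈ finiteMeanMeasures (PathSpace N d) := by
    refine mem_finiteMeanMeasures_of_map_eval fun k => ?_
    rw [hmarg]
    by_cases hk : k = j
    · subst hk; rwa [Function.update_self]
    · rw [Function.update_of_ne hk]
      exact mem_finiteMeanMeasures_of_mem_plans hP.1 k
  have hcost' : ∫⁻ p, ‖p.1 j - p.2‖ₑ ∂(resample P j κ) < ENNReal.ofReal δ := by
    refine lt_of_eq_of_lt ?_ hcost
    rw [← hP.1.2 j, ← resample_map_pair, lintegral_map (by fun_prop) (by fun_prop)]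
  have hint : Integrable (fun p => ‖p.1 j - p.2‖) (resample P j κ) := by
    refine Integrable.norm ⟨(by fun_prop : Measurable _).aestronglyMeasurable, ?_⟩
    exact hcost'.trans ENNReal.ofReal_lt_top
  have hle : ∫ p, ‖p.1 j - p.2‖ ∂(resample P j κ) ≤ δ := by
    rw [integral_norm_eq_lintegral_enorm (by fun_prop : Measurable _).aestronglyMeasurable]
    exact ENNReal.toReal_le_of_le_ofReal hδ.le hcost'.le
  have hmem : P' ∈ approxMartingalePlans (ε + δ) (Function.update μ j (κ ∘ₘ μ j)) := by
    refine ⟨⟨hP', hmarg⟩, hP', fun k hk => ?_⟩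
    refine (integral_norm_condExp_sub_le_iff hP' _ _ _).2 fun h hh => ?_
    refine (integral_testFunction_resample_le hPm κ
      ((integral_norm_condExp_sub_le_iff hPm _ _ _).1 (hP.2.2 k hk)) hP' hint hh).trans ?_
    gcongr
  refine le_trans ?_ (add_le_add_left (le_iSup₂ (f := fun P (_ : P ∈ approxMartingalePlans (ε + δ)
    (Function.update μ j (κ ∘ₘ μ j))) => ((∫ x, c x ∂P : ℝ) : EReal)) P' hmem) _)
  rw [← EReal.coe_add, EReal.coe_le_coe_iff]
  have hcP := integrable_of_lipschitzWith hPm hc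
  have hcP' := integrable_of_lipschitzWith hP' hc
  have h1 : Integrable (fun p : PathSpace N d × State d => c p.1) (resample P j κ) := by
    rw [← resample_map_fst (P := P) j κ] at hcP
    exact (integrable_map_measure hcP.1 measurable_fst.aemeasurable).1 hcP
  have h2 : Integrable (fun p : PathSpace N d × State d => c (replace j p)) (resample P j κ) :=
    (integrable_map_measure hcP'.1 hmr.aemeasurable).1 hcP'
  calc ∫ x, c x ∂P = ∫ p, c p.1 ∂(resample P j κ) := by
        conv_lhs => rw [← resample_map_fst (P := P) j κ]
        rw [integral_map measurable_fst.aemeasurable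
          hc.continuous.measurable.aestronglyMeasurable]
    _ ≤ ∫ p, (c (replace j p) + L * ‖p.1 j - p.2‖) ∂(resample P j κ) := by
        refine integral_mono h1 (h2.add (hint.const_mul _)) fun p => ?_
        have h3 := hc.dist_le_mul p.1 (replace j p)
        -- Path space carries the supremum norm over dates, so changing one coordinate moves the
        -- path by exactly that displacement.
        have h4 : dist p.1 (replace j p) ≤ ‖p.1 j - p.2‖ := by
          refine (dist_pi_le_iff (norm_nonneg _)).2 fun i => ?_
          by_cases hi : i = j
          · subst hi; simp [replace, dist_eq_norm]
          · simp [replace, hi]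
        have h5 := (le_abs_self _).trans (h3.trans (mul_le_mul_of_nonneg_left h4 L.2))
        simp only
        exact sub_le_iff_le_add'.1 h5
    _ = ∫ x, c x ∂P' + L * ∫ p, ‖p.1 j - p.2‖ ∂(resample P j κ) := by
        rw [integral_add h2 (hint.const_mul _), integral_const_mul, hP'def,
          integral_map hmr.aemeasurable hc.continuous.measurable.aestronglyMeasurable]
    _ ≤ ∫ x, c x ∂P' + L * δ := by gcongr

/-- Marginals are exchanged one date at a time; the hybrid vector uses `ν` on `s` and `μ` elsewhere,
and both errors add up. -/
theorem relaxedMOT_le_piecewise {c : PathSpace N d → ℝ} {L : ℝ≥0} (hc : LipschitzWith L c) (ε : ℝ)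
    {δ : Fin N → ℝ} {μ ν : Fin N → Measure (State d)}
    (hW : ∀ j, wasserstein (μ j) (ν j) < ENNReal.ofReal (δ j)) (s : Finset (Fin N)) :
    relaxedMOT c ε μ ≤ relaxedMOT c (ε + ∑ j ∈ s, δ j) (s.piecewise ν μ) +
      ((L * ∑ j ∈ s, δ j : ℝ) : EReal) := by
  induction s using Finset.induction_on with
  | empty => simp
  | insert j s hj ih =>
    refine ih.trans ?_
    have hstep := relaxedMOT_le_update hc (ε + ∑ j ∈ s, δ j) (δ := δ j) (s.piecewise ν μ) j
      (ν := ν j) (by rw [Finset.piecewise_eq_of_notMem _ _ _ hj]; exact hW j)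
    rw [Finset.piecewise_insert, Finset.sum_insert hj]
    refine (add_le_add_left hstep _).trans (le_of_eq ?_)
    rw [add_assoc, ← EReal.coe_add, ← mul_add, add_assoc ε, add_comm (δ j)]

/-- Stability of the relaxed problem with respect to the marginals. -/
theorem relaxedMOT_le_of_wassersteinSum_lt {c : PathSpace N d → ℝ} {L : ℝ≥0}
    (hc : LipschitzWith L c) (ε : ℝ) {δ : ℝ} {μ ν : Fin N → Measure (State d)}
    (hW : wassersteinSum μ ν < ENNReal.ofReal δ) :
    relaxedMOT c ε μ ≤ relaxedMOT c (ε + δ) ν + ((L * δ : ℝ) : EReal) := by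
  have hfin : ∀ j, wasserstein (μ j) (ν j) ≠ ∞ := fun j =>
    ENNReal.sum_ne_top.1 (hW.trans ENNReal.ofReal_lt_top).ne j (Finset.mem_univ j)
  have hsum : ∑ j, (wasserstein (μ j) (ν j)).toReal < δ := by
    rw [← ENNReal.toReal_sum fun j _ => hfin j]
    exact (ENNReal.lt_ofReal_iff_toReal_lt (hW.trans ENNReal.ofReal_lt_top).ne).1 hW
  -- The slack in the strict inequality is shared among the dates, so that each distance lies
  -- strictly below its own budget; `N + 1` avoids division by zero and keeps the total at most `δ`.
  set t := (δ - ∑ j, (wasserstein (μ j) (ν j)).toReal) / (N + 1) with ht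
  have ht0 : 0 < t := div_pos (sub_pos.2 hsum) (by positivity)
  have h1 := relaxedMOT_le_piecewise hc ε (δ := fun j => (wasserstein (μ j) (ν j)).toReal + t)
    (μ := μ) (ν := ν) (fun j => by
      rw [ENNReal.lt_ofReal_iff_toReal_lt (hfin j)]; linarith) Finset.univ
  have h2 : ∑ j, ((wasserstein (μ j) (ν j)).toReal + t) ≤ δ := by
    rw [Finset.sum_add_distrib, Finset.sum_const, Finset.card_univ, Fintype.card_fin, nsmul_eq_mul]
    have : (N + 1) * t = δ - ∑ j, (wasserstein (μ j) (ν j)).toReal := by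
      rw [ht]; field_simp
    nlinarith
  rw [Finset.piecewise_univ] at h1
  refine h1.trans (add_le_add (relaxedMOT_mono c ν (by gcongr)) ?_)
  rw [EReal.coe_le_coe_iff]
  gcongr

/-! ### Finiteness and concavity of the value in the relaxation -/

theorem integral_eval_of_mem_plans {μ : Fin N → Measure (State d)} {P : Measure (PathSpace N d)}
    (hP : P ∈ plans μ) (k : Fin N) {f : State d → ℝ} (hf : Continuous f) :
    ∫ x, f (x k) ∂P = ∫ y, f y ∂(μ k) := by
  rw [← hP.2 k, integral_map (measurable_pi_apply k).aemeasurable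
    hf.measurable.aestronglyMeasurable]

theorem integrable_eval_of_mem_plans {μ : Fin N → Measure (State d)} {P : Measure (PathSpace N d)}
    (hP : P ∈ plans μ) (k : Fin N) {f : State d → ℝ} (hf : Continuous f)
    (hi : Integrable f (μ k)) : Integrable (fun x : PathSpace N d => f (x k)) P := by
  rw [← hP.2 k] at hi
  exact (integrable_map_measure hf.measurable.aestronglyMeasurable
    (measurable_pi_apply k).aemeasurable).1 hi

theorem norm_le_sum_norm (x : PathSpace N d) : ‖x‖ ≤ ∑ k, ‖x k‖ := by
  refine (pi_norm_le_iff_of_nonneg (by positivity)).2 fun k => ?_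
  exact Finset.single_le_sum (f := fun k => ‖x k‖) (fun _ _ => norm_nonneg _) (Finset.mem_univ k)

theorem abs_le_of_lipschitzWith {c : PathSpace N d → ℝ} {L : ℝ≥0} (hc : LipschitzWith L c)
    (x : PathSpace N d) : |c x| ≤ |c 0| + L * ∑ k, ‖x k‖ := by
  have h1 := hc.dist_le_mul x 0
  rw [dist_zero_right, Real.dist_eq] at h1
  have h2 := abs_add_le (c x - c 0) (c 0)
  rw [sub_add_cancel] at h2
  have h3 := mul_le_mul_of_nonneg_left (norm_le_sum_norm x) L.2
  have h4 : (L : ℝ) * ‖x‖ ≤ L * ∑ k, ‖x k‖ := h3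
  linarith

theorem integral_le_of_mem_plans {c : PathSpace N d → ℝ} {L : ℝ≥0} (hc : LipschitzWith L c)
    {μ : Fin N → Measure (State d)} {P : Measure (PathSpace N d)} (hP : P ∈ plans μ) :
    ∫ x, c x ∂P ≤ |c 0| + L * ∑ k, ∫ y, ‖y‖ ∂(μ k) := by
  have := hP.1.1
  have hi (k : Fin N) : Integrable (fun x : PathSpace N d => ‖x k‖) P := (integrable_eval hP.1 k).norm
  calc ∫ x, c x ∂P ≤ ∫ x, (|c 0| + L * ∑ k, ‖x k‖) ∂P :=
        integral_mono (integrable_of_lipschitzWith hP.1 hc)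
          ((integrable_const _).add ((integrable_finsetSum _ fun k _ => hi k).const_mul _))
          fun x => (le_abs_self _).trans (abs_le_of_lipschitzWith hc x)
    _ = _ := by
        rw [integral_add (integrable_const _)
          ((integrable_finsetSum _ fun k _ => hi k).const_mul _), integral_const_mul,
          integral_finsetSum _ fun k _ => hi k]
        simp only [integral_const, probReal_univ, one_smul]
        congr 2
        exact Finset.sum_congr rfl fun k _ => integral_eval_of_mem_plans hP k continuous_norm

theorem approxMartingalePlans_mono {ε ε' : ℝ} (h : ε ≤ ε') (μ : Fin N → Measure (State d)) :
    approxMartingalePlans ε μ ⊆ approxMartingalePlans ε' μ :=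
  fun _ hP => ⟨hP.1, hP.2.1, fun k hk => (hP.2.2 k hk).trans h⟩

theorem integral_le_relaxedMOT (c : PathSpace N d → ℝ) {ε : ℝ} {μ : Fin N → Measure (State d)}
    {P : Measure (PathSpace N d)} (hP : P ∈ approxMartingalePlans ε μ) :
    ((∫ x, c x ∂P : ℝ) : EReal) ≤ relaxedMOT c ε μ :=
  le_iSup₂ (f := fun P (_ : P ∈ approxMartingalePlans ε μ) => ((∫ x, c x ∂P : ℝ) : EReal)) P hP

/-- First moments bound a Lipschitz reward from above uniformly over plans, and a martingale plan
bounds the value from below. A real-valued `p` is what concavity arguments require. -/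
theorem exists_relaxedMOT_eq_coe {c : PathSpace N d → ℝ} {L : ℝ≥0} (hc : LipschitzWith L c)
    {μ : Fin N → Measure (State d)} (hμ : μ ∈ admissibleMarginals N d 0) :
    ∃ p : ℝ → ℝ, ∀ ε, 0 ≤ ε → relaxedMOT c ε μ = p ε := by
  refine ⟨fun ε => (relaxedMOT c ε μ).toReal, fun ε hε => (EReal.coe_toReal ?_ ?_).symm⟩
  · refine ne_of_lt (lt_of_le_of_lt ?_ (EReal.coe_lt_top (|c 0| + L * ∑ k, ∫ y, ‖y‖ ∂(μ k))))
    refine iSup₂_le fun P hP => ?_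
    rw [EReal.coe_le_coe_iff]
    exact integral_le_of_mem_plans hc hP.1
  · obtain ⟨P, hP⟩ := hμ.2
    refine ne_of_gt (lt_of_lt_of_le (EReal.bot_lt_coe _)
      (integral_le_relaxedMOT c (approxMartingalePlans_mono hε μ hP)))

theorem exists_integral_gt {c : PathSpace N d → ℝ} {ε r : ℝ} {μ : Fin N → Measure (State d)}
    (h : (r : EReal) < relaxedMOT c ε μ) :
    ∃ P ∈ approxMartingalePlans ε μ, r < ∫ x, c x ∂P := by
  obtain ⟨P, hP⟩ := lt_iSup_iff.1 h
  obtain ⟨hP, hr⟩ := lt_iSup_iff.1 hP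
  exact ⟨P, hP, EReal.coe_lt_coe_iff.1 hr⟩

theorem integral_mix {E : Type*} [MeasurableSpace E] {P Q : Measure E} {a b : ℝ} (ha : 0 ≤ a)
    (hb : 0 ≤ b) {f : E → ℝ} (hP : Integrable f P) (hQ : Integrable f Q) :
    ∫ x, f x ∂(ENNReal.ofReal a • P + ENNReal.ofReal b • Q) = a * ∫ x, f x ∂P + b * ∫ x, f x ∂Q := by
  rw [integral_add_measure (hP.smul_measure ENNReal.ofReal_ne_top)
    (hQ.smul_measure ENNReal.ofReal_ne_top), integral_smul_measure, integral_smul_measure,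
    ENNReal.toReal_ofReal ha, ENNReal.toReal_ofReal hb]
  rfl

/-- The conditional expectation depends on the measure nonlinearly, but each dual inequality is
linear in it, so the defect is convex under mixing. -/
theorem mix_mem_approxMartingalePlans {μ : Fin N → Measure (State d)} {P Q : Measure (PathSpace N d)}
    {ε ε' a b : ℝ} (hP : P ∈ approxMartingalePlans ε μ) (hQ : Q ∈ approxMartingalePlans ε' μ)
    (ha : 0 ≤ a) (hb : 0 ≤ b) (hab : a + b = 1) :
    ENNReal.ofReal a • P + ENNReal.ofReal b • Q ∈ approxMartingalePlans (a * ε + b * ε') μ := by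
  have := hP.1.1.1
  have := hQ.1.1.1
  have hab' : ENNReal.ofReal a + ENNReal.ofReal b = 1 := by
    rw [← ENNReal.ofReal_add ha hb, hab, ENNReal.ofReal_one]
  have hR : ENNReal.ofReal a • P + ENNReal.ofReal b • Q ∈ finiteMeanMeasures (PathSpace N d) :=
    ⟨⟨by simp [hab']⟩, (hP.1.1.2.smul_measure ENNReal.ofReal_ne_top).add_measure
      (hQ.1.1.2.smul_measure ENNReal.ofReal_ne_top)⟩
  refine ⟨⟨hR, fun k => ?_⟩, hR, fun k hk => ?_⟩
  · rw [Measure.map_add _ _ (measurable_pi_apply k), Measure.map_smul, Measure.map_smul, hP.1.2 k,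
      hQ.1.2 k, ← add_smul, hab', one_smul]
  · refine (integral_norm_condExp_sub_le_iff hR _ _ _).2 fun h hh => ?_
    rw [integral_mix ha hb (hh.integrable_sum hP.1.1) (hh.integrable_sum hQ.1.1)]
    have h1 := (integral_norm_condExp_sub_le_iff hP.1.1 _ _ _).1 (hP.2.2 k hk) h hh
    have h2 := (integral_norm_condExp_sub_le_iff hQ.1.1 _ _ _).1 (hQ.2.2 k hk) h hh
    gcongr

theorem concaveOn_relaxedMOT {c : PathSpace N d → ℝ} {L : ℝ≥0} (hc : LipschitzWith L c)
    {μ : Fin N → Measure (State d)} {p : ℝ → ℝ} (hp : ∀ ε, 0 ≤ ε → relaxedMOT c ε μ = p ε) :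
    ConcaveOn ℝ (Set.Ici 0) p := by
  refine ⟨convex_Ici 0, fun ε hε ε' hε' a b ha hb hab => ?_⟩
  simp only [smul_eq_mul]
  have h0 : 0 ≤ a * ε + b * ε' := add_nonneg (mul_nonneg ha hε) (mul_nonneg hb hε')
  refine le_of_forall_pos_le_add fun η hη => ?_
  obtain ⟨P, hP, h1⟩ := exists_integral_gt (c := c) (r := p ε - η) (μ := μ) (ε := ε)
    (by rw [hp ε hε, EReal.coe_lt_coe_iff]; linarith)
  obtain ⟨Q, hQ, h2⟩ := exists_integral_gt (c := c) (r := p ε' - η) (μ := μ) (ε := ε')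
    (by rw [hp ε' hε', EReal.coe_lt_coe_iff]; linarith)
  have h3 := integral_le_relaxedMOT c (mix_mem_approxMartingalePlans hP hQ ha hb hab)
  rw [hp _ h0, EReal.coe_le_coe_iff, integral_mix ha hb (integrable_of_lipschitzWith hP.1.1 hc)
    (integrable_of_lipschitzWith hQ.1.1 hc)] at h3
  have h4 := mul_le_mul_of_nonneg_left h1.le ha
  have h5 := mul_le_mul_of_nonneg_left h2.le hb
  have h6 : (a + b) * η = η := by rw [hab, one_mul]
  linarith

/-! ### Compactness of plans and right-continuity at zero -/

theorem tendsto_integral_excess {ν : Measure (State d)} (hν : Integrable (fun y : State d => y) ν) :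
    Tendsto (fun R : ℕ => ∫ y, max (‖y‖ - R) 0 ∂ν) atTop (𝓝 0) := by
  have h := tendsto_integral_of_dominated_convergence (μ := ν)
    (F := fun (R : ℕ) (y : State d) => max (‖y‖ - R) 0) (f := fun _ => 0) (fun y => ‖y‖)
    (fun R => (by fun_prop : Measurable _).aestronglyMeasurable) hν.norm
    (fun R => ae_of_all _ fun y => ?_) (ae_of_all _ fun y => ?_)
  · simpa using h
  · rw [Real.norm_eq_abs, abs_of_nonneg (le_max_right _ _)]
    exact max_le (by linarith [(Nat.cast_nonneg R : (0 : ℝ) ≤ R)]) (norm_nonneg y)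
  · obtain ⟨R₀, hR₀⟩ := exists_nat_ge ‖y‖
    refine tendsto_const_nhds.congr' ((eventually_ge_atTop R₀).mono fun R hR => ?_)
    have : (R₀ : ℝ) ≤ R := by exact_mod_cast hR
    exact (max_eq_right (by linarith)).symm

theorem integrable_excess {ν : Measure (State d)} [IsFiniteMeasure ν]
    (hν : Integrable (fun y : State d => y) ν) (R : ℝ) :
    Integrable (fun y : State d => max (‖y‖ - R) 0) ν :=
  (hν.norm.sub (integrable_const R)).sup (integrable_const 0)

theorem abs_sub_clamp_le {t M s : ℝ} (hM : 0 ≤ M) (hs : 0 ≤ s) (h : |t| ≤ M + s) :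
    |t - max (-M) (min t M)| ≤ s := by
  obtain ⟨h1, h2⟩ := abs_le.1 h
  rw [abs_le]
  rcases le_total t M with ht | ht
  · rw [min_eq_left ht]
    rcases le_total (-M) t with ht' | ht'
    · rw [max_eq_right ht']; constructor <;> linarith
    · rw [max_eq_left ht']; constructor <;> linarith
  · rw [min_eq_right ht, max_eq_right (by linarith)]; constructor <;> linarith

/-- Weak convergence of plans with common marginals is tested by continuous functions of linear
growth. -/
theorem tendsto_integral_of_mem_plans {ι : Type*} {l : Filter ι}
    {Q : ι → ProbabilityMeasure (PathSpace N d)} {Q₀ : ProbabilityMeasure (PathSpace N d)}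
    (hQ : Tendsto Q l (𝓝 Q₀)) {μ : Fin N → Measure (State d)}
    (h : ∀ i, (Q i : Measure (PathSpace N d)) ∈ plans μ)
    (h₀ : (Q₀ : Measure (PathSpace N d)) ∈ plans μ) {g : PathSpace N d → ℝ} (hg : Continuous g)
    {A B : ℝ} (hA : 0 ≤ A) (hB : 0 ≤ B) (hgb : ∀ x, |g x| ≤ A + B * ∑ k, ‖x k‖) :
    Tendsto (fun i => ∫ x, g x ∂(Q i : Measure (PathSpace N d))) l
      (𝓝 (∫ x, g x ∂(Q₀ : Measure (PathSpace N d)))) := by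
  have hμ (k : Fin N) := mem_finiteMeanMeasures_of_mem_plans h₀ k
  set τ : ℕ → ℝ := fun R => B * ∑ k, ∫ y, max (‖y‖ - R) 0 ∂(μ k) with hτ
  have hτ0 : Tendsto τ atTop (𝓝 0) := by
    have := (tendsto_finsetSum Finset.univ fun k _ =>
      tendsto_integral_excess (hμ k).2).const_mul B
    simpa using this
  -- Clamping `g` at the level it can reach when all `‖x k‖ ≤ R` leaves an error of at most `B ∑ (‖x
  -- k‖ - R)⁺`. Its integral depends on the marginals only, so it is small uniformly over plans.
  set M : ℕ → ℝ := fun R => A + B * (N * R) with hM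
  have hM0 : ∀ R, 0 ≤ M R := fun R => by positivity
  set G : ℕ → PathSpace N d → ℝ := fun R x => max (-M R) (min (g x) (M R)) with hG
  have hGc : ∀ R, Continuous (G R) := fun R => by fun_prop
  have hGb : ∀ R x, ‖G R x‖ ≤ M R := fun R x => by
    rw [Real.norm_eq_abs, abs_le]
    exact ⟨le_max_left _ _, max_le (by linarith [hM0 R]) (min_le_right _ _)⟩
  have hpt : ∀ R x, |g x - G R x| ≤ B * ∑ k, max (‖x k‖ - (R : ℝ)) 0 := by
    intro R x
    have hs : 0 ≤ ∑ k, max (‖x k‖ - (R : ℝ)) 0 := Finset.sum_nonneg fun k _ => le_max_right _ _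
    refine abs_sub_clamp_le (hM0 R) (by positivity) ((hgb x).trans ?_)
    have h1 : ∑ k, (‖x k‖ - (R : ℝ)) ≤ ∑ k, max (‖x k‖ - (R : ℝ)) 0 :=
      Finset.sum_le_sum fun k _ => le_max_left _ _
    rw [Finset.sum_sub_distrib, Finset.sum_const, Finset.card_univ, Fintype.card_fin,
      nsmul_eq_mul] at h1
    have h2 := mul_le_mul_of_nonneg_left h1 hB
    simp only [hM]
    linarith
  have herr : ∀ R (P : Measure (PathSpace N d)), P ∈ plans μ →
      |∫ x, g x ∂P - ∫ x, G R x ∂P| ≤ τ R := by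
    intro R P hP
    have := hP.1.1
    have hm (k : Fin N) := (hμ k).1
    have hex (k : Fin N) : Integrable (fun x : PathSpace N d => max (‖x k‖ - (R : ℝ)) 0) P :=
      integrable_eval_of_mem_plans hP k (f := fun y => max (‖y‖ - (R : ℝ)) 0) (by fun_prop)
        (integrable_excess (hμ k).2 R)
    have hgi : Integrable g P := by
      refine ((integrable_const A).add ((integrable_finsetSum Finset.univ fun k _ =>
        (integrable_eval hP.1 k).norm).const_mul B)).mono'
        hg.measurable.aestronglyMeasurable (ae_of_all _ fun x => ?_)
      simpa using hgb x
    have hGi : Integrable (G R) P :=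
      Integrable.of_bound (hGc R).measurable.aestronglyMeasurable (M R) (ae_of_all _ (hGb R))
    rw [← integral_sub hgi hGi]
    refine (abs_integral_le_integral_abs).trans ?_
    calc ∫ x, |g x - G R x| ∂P ≤ ∫ x, B * ∑ k, max (‖x k‖ - (R : ℝ)) 0 ∂P :=
          integral_mono (hgi.sub hGi).abs ((integrable_finsetSum _ fun k _ => hex k).const_mul _)
            (hpt R)
      _ = τ R := by
          rw [integral_const_mul, integral_finsetSum _ fun k _ => hex k, hτ]
          simp only
          congr 1
          exact Finset.sum_congr rfl fun k _ =>
            integral_eval_of_mem_plans hP k (f := fun y => max (‖y‖ - (R : ℝ)) 0) (by fun_prop)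
  rw [Metric.tendsto_nhds]
  intro e he
  obtain ⟨R, hR⟩ := (hτ0.eventually (gt_mem_nhds (by positivity : (0 : ℝ) < e / 3))).exists
  have hw := ProbabilityMeasure.tendsto_iff_forall_integral_tendsto.1 hQ
    (BoundedContinuousFunction.ofNormedAddCommGroup (G R) (hGc R) (M R) (hGb R))
  filter_upwards [Metric.tendsto_nhds.1 hw (e / 3) (by positivity)] with i hi
  simp only [BoundedContinuousFunction.coe_ofNormedAddCommGroup, Real.dist_eq] at hi ⊢
  have h1 := abs_lt.1 ((herr R _ (h i)).trans_lt hR)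
  have h2 := abs_lt.1 ((herr R _ h₀).trans_lt hR)
  have h3 := abs_lt.1 hi
  rw [abs_lt]
  constructor <;> linarith [h1.1, h1.2, h2.1, h2.2, h3.1, h3.2]

/-- Each marginal is a single tight measure; a product of compact sets, each losing mass at most `ε
/ N`, serves every plan. -/
theorem isTightMeasureSet_plans (μ : Fin N → Measure (State d)) :
    IsTightMeasureSet (plans μ) := by
  rw [isTightMeasureSet_iff_exists_isCompact_measure_compl_le]
  intro ε hε
  rcases (plans μ).eq_empty_or_nonempty with hemp | ⟨P₀, hP₀⟩
  · exact ⟨∅, isCompact_empty, by simp [hemp]⟩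
  have hex : ∀ k, ∃ K : Set (State d), IsCompact K ∧ μ k Kᶜ ≤ ε / N := by
    intro k
    have := (mem_finiteMeanMeasures_of_mem_plans hP₀ k).1
    obtain ⟨K, hK, hle⟩ := isTightMeasureSet_iff_exists_isCompact_measure_compl_le.1
      (isTightMeasureSet_singleton (μ := μ k)) (ε / N)
      (ENNReal.div_pos hε.ne' (ENNReal.natCast_ne_top N))
    exact ⟨K, hK, hle _ rfl⟩
  choose K hK hle using hex
  refine ⟨Set.univ.pi K, isCompact_univ_pi hK, fun P hP => ?_⟩
  have hsub : (Set.univ.pi K)ᶜ ⊆ ⋃ k, (fun x : PathSpace N d => x k) ⁻¹' (K k)ᶜ := by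
    intro x hx
    simpa using hx
  calc P (Set.univ.pi K)ᶜ ≤ ∑ k, P ((fun x : PathSpace N d => x k) ⁻¹' (K k)ᶜ) :=
        (measure_mono hsub).trans (measure_iUnion_fintype_le _ _)
    _ ≤ ∑ _ : Fin N, ε / N := by
        refine Finset.sum_le_sum fun k _ => ?_
        rw [← Measure.map_apply (measurable_pi_apply k) (hK k).measurableSet.compl, hP.2 k]
        exact hle k
    _ ≤ ε := by
        rw [Finset.sum_const, Finset.card_univ, Fintype.card_fin, nsmul_eq_mul]
        exact ENNReal.mul_div_le

theorem mem_plans_of_tendsto {ι : Type*} {l : Filter ι} [l.NeBot]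
    {Q : ι → ProbabilityMeasure (PathSpace N d)} {Q₀ : ProbabilityMeasure (PathSpace N d)}
    (hQ : Tendsto Q l (𝓝 Q₀)) {μ : Fin N → Measure (State d)}
    (h : ∀ i, (Q i : Measure (PathSpace N d)) ∈ plans μ) :
    (Q₀ : Measure (PathSpace N d)) ∈ plans μ := by
  obtain ⟨i₀⟩ := l.nonempty_of_neBot
  have hmarg : ∀ k, (Q₀ : Measure (PathSpace N d)).map (fun x : PathSpace N d => x k) = μ k := by
    intro k
    have ht := ProbabilityMeasure.tendsto_map_of_tendsto_of_continuous Q Q₀ hQ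
      (f := fun x : PathSpace N d => x k) (continuous_apply k)
    have hconst : ∀ i, (Q i).map (f := fun x : PathSpace N d => x k)
        (continuous_apply k).measurable.aemeasurable = (Q i₀).map
        (f := fun x : PathSpace N d => x k) (continuous_apply k).measurable.aemeasurable := by
      intro i
      ext1
      rw [ProbabilityMeasure.toMeasure_map, ProbabilityMeasure.toMeasure_map, (h i).2 k,
        (h i₀).2 k]
    simp only [hconst] at ht
    have := congrArg (fun P : ProbabilityMeasure (State d) => (P : Measure (State d)))
      (tendsto_nhds_unique ht tendsto_const_nhds)
    simp only [ProbabilityMeasure.toMeasure_map] at this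
    rw [this, (h i₀).2 k]
  refine ⟨⟨inferInstance, Integrable.of_eval fun k => ?_⟩, hmarg⟩
  have hk := (mem_finiteMeanMeasures_of_mem_plans (h i₀) k).2
  rw [← hmarg k] at hk
  exact (integrable_map_measure aestronglyMeasurable_id (measurable_pi_apply k).aemeasurable).1 hk

/-- A function orthogonal to the bounded continuous functions of `T` is orthogonal to the bounded
measurable functions of `T`. -/
theorem integral_comp_mul_eq_zero {E : Type*} [TopologicalSpace E] [HasOuterApproxClosed E]
    [MeasurableSpace E] [BorelSpace E] {P : Measure E} [IsFiniteMeasure P] {T : E → E}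
    (hT : Measurable T) {D : E → ℝ} (hDm : Measurable D) (hD : Integrable D P)
    (H : ∀ φ : BoundedContinuousFunction E ℝ, ∫ x, φ (T x) * D x ∂P = 0) {f : E → ℝ}
    (hf : Measurable f) {C : ℝ} (hfC : ∀ x, |f x| ≤ C) : ∫ x, f (T x) * D x ∂P = 0 := by
  have hfin (g : E → ℝ) (hg : Integrable g P) :
      IsFiniteMeasure (P.withDensity fun x => ENNReal.ofReal (g x)) :=
    isFiniteMeasure_withDensity_ofReal hg.2
  have h1 := hfin D hD
  have h2 := hfin (fun x => -D x) hD.neg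
  -- The positive and negative parts of `D`, taken as densities and pushed forward by `T`, are
  -- finite measures whose difference represents the functional. Agreement on bounded continuous
  -- functions makes them equal.
  have key : ∀ {f : E → ℝ}, Measurable f → ∀ {C : ℝ}, (∀ x, |f x| ≤ C) →
      ∫ x, f (T x) * D x ∂P =
        ∫ x, f x ∂((P.withDensity fun x => ENNReal.ofReal (D x)).map T) -
        ∫ x, f x ∂((P.withDensity fun x => ENNReal.ofReal (-D x)).map T) := by
    intro f hf C hfC
    rw [integral_map hT.aemeasurable hf.aestronglyMeasurable,
      integral_map hT.aemeasurable hf.aestronglyMeasurable,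
      integral_withDensity_eq_integral_toReal_smul (by fun_prop)
        (ae_of_all _ fun x => ENNReal.ofReal_lt_top),
      integral_withDensity_eq_integral_toReal_smul (by fun_prop)
        (ae_of_all _ fun x => ENNReal.ofReal_lt_top), ← integral_sub]
    · refine integral_congr_ae (ae_of_all _ fun x => ?_)
      simp only [smul_eq_mul, ENNReal.toReal_ofReal', ← sub_mul]
      rw [mul_comm]
      congr 1
      rcases le_total 0 (D x) with h | h
      · rw [max_eq_left h, max_eq_right (by linarith), sub_zero]
      · rw [max_eq_right h, max_eq_left (by linarith)]; ring
    all_goals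
      simp only [smul_eq_mul, ENNReal.toReal_ofReal']
      refine Integrable.mul_bdd (c := C) ?_ (hf.comp hT).aestronglyMeasurable
        (ae_of_all _ fun x => hfC _)
    · exact hD.pos_part
    · exact hD.neg.pos_part
  have heq : (P.withDensity fun x => ENNReal.ofReal (D x)).map T =
      (P.withDensity fun x => ENNReal.ofReal (-D x)).map T := by
    refine ext_of_forall_integral_eq_of_IsFiniteMeasure fun φ => ?_
    have := key φ.continuous.measurable (fun x => φ.norm_coe_le_norm x)
    rw [H φ] at this
    linarith
  rw [key hf hfC, heq, sub_self]

theorem isTestFunction_single {k : Fin N} (φ : BoundedContinuousFunction (PathSpace N d) ℝ)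
    (i : Fin d) {a : ℝ} (ha : |a| * ‖φ‖ ≤ 1) :
    IsTestFunction k fun x => Pi.single i (a * φ (trunc k x)) := by
  refine ⟨measurable_pi_iff.2 fun i' => ?_, fun x => by simp only [trunc_trunc], fun x i' => ?_⟩
  · by_cases h : i' = i
    · subst h
      simp only [Pi.single_eq_same]
      exact (φ.continuous.measurable.comp (measurable_trunc k)).const_mul a
    · simp [h]
  · by_cases h : i' = i
    · subst h
      rw [Pi.single_eq_same, abs_mul]
      exact (mul_le_mul_of_nonneg_left (φ.norm_coe_le_norm _) (abs_nonneg a)).trans ha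
    · simp [h]

/-- Test with `±φ / (‖φ‖ + 1)` placed in the `i`-th entry; the added `1` keeps the normalisation
valid when `φ = 0`. -/
theorem abs_integral_trunc_mul_le {P : Measure (PathSpace N d)} {j k : Fin N} {ε : ℝ}
    (H : ∀ h : PathSpace N d → Fin d → ℝ, IsTestFunction k h →
      ∫ x, ∑ i, h x i * (x j i - x k i) ∂P ≤ ε)
    (φ : BoundedContinuousFunction (PathSpace N d) ℝ) (i : Fin d) :
    |∫ x, φ (trunc k x) * (x j i - x k i) ∂P| ≤ (‖φ‖ + 1) * ε := by
  have hpos : 0 < ‖φ‖ + 1 := by positivity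
  have main : ∀ s : ℝ, |s| = 1 →
      s * ∫ x, φ (trunc k x) * (x j i - x k i) ∂P ≤ (‖φ‖ + 1) * ε := by
    intro s hs
    have h1 := H _ (isTestFunction_single (k := k) φ i (a := s / (‖φ‖ + 1)) (by
      rw [abs_div, hs, abs_of_pos hpos, one_div, inv_mul_le_iff₀ hpos]
      linarith))
    have h2 : ∀ x : PathSpace N d, ∑ i', (Pi.single i (s / (‖φ‖ + 1) * φ (trunc k x)) :
        Fin d → ℝ) i' * (x j i' - x k i') =
        s / (‖φ‖ + 1) * (φ (trunc k x) * (x j i - x k i)) := by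
      intro x
      rw [Finset.sum_eq_single i (fun b _ hb => by simp [hb]) (by simp), Pi.single_eq_same,
        mul_assoc]
    simp only [h2] at h1
    rw [integral_const_mul, div_mul_eq_mul_div, div_le_iff₀ hpos] at h1
    linarith
  have h1 := main 1 (by simp)
  have h2 := main (-1) (by simp)
  rw [abs_le]
  constructor <;> linarith

/-- Limits of relaxed martingale plans with vanishing defect are martingale plans. -/
theorem mem_approxMartingalePlans_zero_of_tendsto {ι : Type*} {l : Filter ι} [l.NeBot]
    {Q : ι → ProbabilityMeasure (PathSpace N d)} {Q₀ : ProbabilityMeasure (PathSpace N d)}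
    (hQ : Tendsto Q l (𝓝 Q₀)) {μ : Fin N → Measure (State d)} {ε : ι → ℝ}
    (hε : Tendsto ε l (𝓝 0))
    (h : ∀ i, (Q i : Measure (PathSpace N d)) ∈ approxMartingalePlans (ε i) μ) :
    (Q₀ : Measure (PathSpace N d)) ∈ approxMartingalePlans 0 μ := by
  have h₀ := mem_plans_of_tendsto hQ fun i => (h i).1
  refine ⟨h₀, h₀.1, fun k hk => ?_⟩
  refine (integral_norm_condExp_sub_le_iff h₀.1 _ _ _).2 fun f hf => le_of_eq ?_
  generalize_proofs hk'
  generalize hj : (⟨k + 1, hk⟩ : Fin N) = j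
  generalize hl : (⟨k, hk'⟩ : Fin N) = l' at hf ⊢
  have hbound (n : ι) := (integral_norm_condExp_sub_le_iff (h n).1.1 _ _ _).1 ((h n).2.2 k hk)
  simp only [hj, hl] at hbound
  -- Weak limits only see continuous integrands. Since `trunc` is continuous, the identity passes to
  -- the limit for continuous `φ`; `integral_comp_mul_eq_zero` then extends it to measurable test
  -- functions.
  have hzero : ∀ (i : Fin d) (φ : BoundedContinuousFunction (PathSpace N d) ℝ),
      ∫ x, φ (trunc l' x) * (x j i - x l' i) ∂(Q₀ : Measure (PathSpace N d)) = 0 := by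
    intro i φ
    have hcont : Continuous fun x : PathSpace N d => φ (trunc l' x) * (x j i - x l' i) := by
      have := φ.continuous.comp (continuous_trunc (d := d) l')
      exact this.mul (by fun_prop)
    have hcoord : ∀ (x : PathSpace N d) (m : Fin N), |x m i| ≤ ∑ n, ‖x n‖ := by
      intro x m
      refine le_trans ?_ (Finset.single_le_sum (f := fun n => ‖x n‖) (fun _ _ => norm_nonneg _)
        (Finset.mem_univ m))
      simp only
      rw [PiLp.norm_eq_of_L1]
      exact Finset.single_le_sum (f := fun i => ‖x m i‖) (fun _ _ => norm_nonneg _)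
        (Finset.mem_univ i)
    have hlim := tendsto_integral_of_mem_plans hQ (fun n => (h n).1) h₀ hcont (A := 0)
      (B := ‖φ‖ * 2) le_rfl (by positivity) (fun x => by
        rw [abs_mul, zero_add, mul_assoc]
        refine mul_le_mul (φ.norm_coe_le_norm _) ?_ (abs_nonneg _) (norm_nonneg _)
        have := abs_sub (x j i) (x l' i)
        linarith [hcoord x j, hcoord x l'])
    have hlim' : Tendsto (fun n => ∫ x, φ (trunc l' x) * (x j i - x l' i)
        ∂(Q n : Measure (PathSpace N d))) l (𝓝 0) := by
      refine squeeze_zero_norm (fun n => abs_integral_trunc_mul_le (hbound n) φ i) ?_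
      simpa using hε.const_mul (‖φ‖ + 1)
    exact tendsto_nhds_unique hlim hlim'
  have hD (i : Fin d) : Integrable (fun x : PathSpace N d => x j i - x l' i)
      (Q₀ : Measure (PathSpace N d)) :=
    (integrable_coord h₀.1 j i).sub (integrable_coord h₀.1 l' i)
  rw [integral_finsetSum _ fun i _ => hf.integrable_mul (hD i) i]
  refine Finset.sum_eq_zero fun i _ => ?_
  have := integral_comp_mul_eq_zero (measurable_trunc l') (by fun_prop) (hD i) (hzero i)
    (hf.measurable_apply i) (fun x => hf.abs_le_one x i)
  simpa only [hf.trunc_eq] using this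

/-- Right-continuity of the value of the relaxed problem at zero relaxation. -/
theorem exists_relaxedMOT_le {c : PathSpace N d → ℝ} {L : ℝ≥0} (hc : LipschitzWith L c)
    {μ : Fin N → Measure (State d)} {r : ℝ} (hr : relaxedMOT c 0 μ < r) :
    ∃ ε > 0, relaxedMOT c ε μ ≤ r := by
  by_contra! hcon
  have hex : ∀ n : ℕ, ∃ P ∈ approxMartingalePlans (1 / ((n : ℝ) + 1)) μ, r < ∫ x, c x ∂P :=
    fun n => exists_integral_gt (hcon _ (by positivity))
  choose P hP hPr using hex
  have (n : ℕ) := (hP n).1.1.1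
  let Q : ℕ → ProbabilityMeasure (PathSpace N d) := fun n => ⟨P n, this n⟩
  have hK := isCompact_closure_of_isTightMeasureSet
    (S := {Q : ProbabilityMeasure (PathSpace N d) | (Q : Measure (PathSpace N d)) ∈ plans μ})
    ((isTightMeasureSet_plans μ).subset (by rintro _ ⟨Q, hQ, rfl⟩; exact hQ))
  -- Near-violating plans with relaxation `1 / (n + 1)` lie in a compact set; a limit along an
  -- ultrafilter replaces the extraction of a subsequence.
  obtain ⟨Q₀, -, hQ₀⟩ := hK.ultrafilter_le_nhds ((hyperfilter ℕ).map Q) (by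
    rw [le_principal_iff]
    exact Filter.mem_map.2 (Filter.univ_mem' fun n => subset_closure (hP n).1))
  have hlim : Tendsto Q (hyperfilter ℕ : Filter ℕ) (𝓝 Q₀) := hQ₀
  have hε : Tendsto (fun n : ℕ => 1 / ((n : ℝ) + 1)) (hyperfilter ℕ : Filter ℕ) (𝓝 0) :=
    tendsto_one_div_add_atTop_nhds_zero_nat.mono_left Nat.hyperfilter_le_atTop
  have hmem := mem_approxMartingalePlans_zero_of_tendsto hlim hε hP
  have hint := tendsto_integral_of_mem_plans hlim (fun n => (hP n).1) hmem.1 hc.continuous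
    (abs_nonneg (c 0)) L.2 (abs_le_of_lipschitzWith hc)
  have h1 : r ≤ ∫ x, c x ∂(Q₀ : Measure (PathSpace N d)) :=
    ge_of_tendsto hint (Eventually.of_forall fun n => (hPr n).le)
  have h2 := (integral_le_relaxedMOT c hmem).trans_lt hr
  rw [EReal.coe_lt_coe_iff] at h2
  exact absurd h1 (not_le.2 h2)

/-! ### Empirical measures: almost sure convergence and measurability -/

theorem lintegral_empiricalMeasure (x : ℕ → State d) (n : ℕ) (f : State d → ℝ≥0∞) :
    ∫⁻ y, f y ∂(empiricalMeasure x n) = (n : ℝ≥0∞)⁻¹ * ∑ i ∈ Finset.range n, f (x i) := by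
  rw [empiricalMeasure, lintegral_smul_measure, lintegral_finsetSum_measure]
  simp [lintegral_dirac]

theorem empiricalMeasure_mem_finiteMeanMeasures (x : ℕ → State d) {n : ℕ} (hn : n ≠ 0) :
    empiricalMeasure x n ∈ finiteMeanMeasures (State d) := by
  have hn' : (n : ℝ≥0∞) ≠ 0 := by exact_mod_cast hn
  refine ⟨⟨?_⟩, measurable_id.aestronglyMeasurable, ?_⟩
  · have := lintegral_empiricalMeasure x n fun _ => 1
    simpa [ENNReal.inv_mul_cancel hn' (ENNReal.natCast_ne_top n)] using this
  · rw [hasFiniteIntegral_iff_enorm, lintegral_empiricalMeasure]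
    refine ENNReal.mul_lt_top (ENNReal.inv_lt_top.2 (pos_iff_ne_zero.2 hn')) ?_
    exact ENNReal.sum_lt_top.2 fun i _ => enorm_lt_top

theorem wasserstein_map_le {α : Measure (State d)} (hα : α ∈ finiteMeanMeasures (State d))
    {T : State d → State d} (hT : Measurable T) (hTi : Integrable T α) :
    wasserstein α (α.map T) ≤ ∫⁻ y, ‖y - T y‖ₑ ∂α := by
  have := hα.1
  have hm : Measurable fun y => (y, T y) := by fun_prop
  refine (wasserstein_le_of_coupling (ρ := α.map fun y => (y, T y)) hα
    (mem_finiteMeanMeasures_map hT hTi) ?_ ?_).trans (le_of_eq ?_)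
  · rw [Measure.map_map measurable_fst hm]
    exact Measure.map_id
  · rw [Measure.map_map measurable_snd hm]
    rfl
  · rw [lintegral_map (by fun_prop) hm]

/-- If `α` dominates `(1 - θ) β`, then a mass `1 - θ` can be left in place. -/
theorem wasserstein_le_of_smul_le {α β : Measure (State d)} (hα : α ∈ finiteMeanMeasures (State d))
    (hβ : β ∈ finiteMeanMeasures (State d)) {θ : ℝ≥0∞} (hθ : θ ≤ 1) (hle : (1 - θ) • β ≤ α)
    {R : ℝ≥0∞} (hRα : ∀ᵐ y ∂α, ‖y‖ₑ ≤ R) (hRβ : ∀ᵐ y ∂β, ‖y‖ₑ ≤ R) :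
    wasserstein β α ≤ (R + R) * θ := by
  have := hα.1
  have := hβ.1
  have h1θ : 1 - θ ≠ ∞ := (tsub_le_self.trans_lt ENNReal.one_lt_top).ne
  have hfin : IsFiniteMeasure ((1 - θ) • β) := Measure.smul_finite β h1θ
  set σ := α - (1 - θ) • β with hσ
  have hσα : σ + (1 - θ) • β = α := Measure.sub_add_cancel_of_le hle
  have hσle : σ ≤ α := Measure.sub_le
  have : IsFiniteMeasure σ := isFiniteMeasure_of_le α hσle
  have hmass : σ Set.univ = θ := by
    have h1 := congrArg (fun m : Measure (State d) => m Set.univ) hσα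
    simp only [Measure.add_apply, Measure.smul_apply, measure_univ, smul_eq_mul, mul_one] at h1
    have h2 : σ Set.univ + (1 - θ) = θ + (1 - θ) := by rw [h1, add_tsub_cancel_of_le hθ]
    exact (ENNReal.add_left_inj h1θ).1 h2
  have hdiag : Measurable fun y : State d => (y, y) := by fun_prop
  -- The part `(1 - θ) β` stays on the diagonal; the remaining mass `θ` of `α`, namely `σ`, is
  -- coupled with `β` independently. Only this second part costs anything, at most `R + R` per unit
  -- of mass.
  refine (wasserstein_le_of_coupling
    (ρ := ((1 - θ) • β).map (fun y => (y, y)) + β.prod σ) hβ hα ?_ ?_).trans ?_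
  · rw [Measure.map_add _ _ measurable_fst, Measure.map_map measurable_fst hdiag,
      Measure.map_fst_prod, hmass]
    change ((1 - θ) • β).map id + _ = _
    rw [Measure.map_id, ← add_smul, tsub_add_cancel_of_le hθ, one_smul]
  · rw [Measure.map_add _ _ measurable_snd, Measure.map_map measurable_snd hdiag,
      Measure.map_snd_prod, measure_univ, one_smul]
    change ((1 - θ) • β).map id + _ = _
    rw [Measure.map_id, add_comm, hσα]
  · rw [lintegral_add_measure, lintegral_map (by fun_prop) hdiag]
    simp only [sub_self, enorm_zero, lintegral_zero, zero_add]
    rw [lintegral_prod _ (by fun_prop)]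
    calc ∫⁻ x, ∫⁻ y, ‖x - y‖ₑ ∂σ ∂β ≤ ∫⁻ _, (R + R) * θ ∂β := by
          refine lintegral_mono_ae (hRβ.mono fun x hx => ?_)
          rw [← hmass, ← lintegral_const]
          refine lintegral_mono_ae ?_
          filter_upwards [(Measure.absolutelyContinuous_of_le hσle).ae_le hRα] with y hy
          exact enorm_sub_le.trans (add_le_add hx hy)
      _ = (R + R) * θ := by simp

theorem smul_le_of_singleton {E : Type*} [MeasurableSpace E] [MeasurableSingletonClass E]
    {α β : Measure E} {F : Finset E} (hβ : β (F : Set E)ᶜ = 0) {a : ℝ≥0∞}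
    (h : ∀ v ∈ F, a * β {v} ≤ α {v}) : a • β ≤ α := by
  classical
  refine Measure.le_iff.2 fun A hA => ?_
  have hAF : A ∩ F = ((F.filter (· ∈ A) : Finset E) : Set E) := by
    ext v; simp [and_comm]
  calc (a • β) A = a * β (A ∩ F) := by
        rw [Measure.smul_apply, smul_eq_mul, measure_inter_conull hβ]
    _ = ∑ v ∈ F.filter (· ∈ A), a * β {v} := by
        rw [hAF, ← sum_measure_singleton, Finset.mul_sum]
    _ ≤ ∑ v ∈ F.filter (· ∈ A), α {v} :=
        Finset.sum_le_sum fun v hv => h v (Finset.mem_filter.1 hv).1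
    _ = α (A ∩ F) := by rw [hAF, ← sum_measure_singleton]
    _ ≤ α A := measure_mono Set.inter_subset_left

/-- Pass from the empirical measure to its image under `T`, then to the image of `μ`, then to `μ`.
The outer moves cost the quantisation error; the middle one compares measures on finitely many
atoms, whose weights converge. -/
theorem eventually_wasserstein_empiricalMeasure_le {μ : Measure (State d)}
    (hμ : μ ∈ finiteMeanMeasures (State d)) (T : SimpleFunc (State d) (State d)) {η : ℝ≥0∞}
    (hη : ∫⁻ y, ‖y - T y‖ₑ ∂μ < η) {x : ℕ → State d}
    (h₁ : Tendsto (fun n => ∫⁻ y, ‖y - T y‖ₑ ∂(empiricalMeasure x n)) atTop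
      (𝓝 (∫⁻ y, ‖y - T y‖ₑ ∂μ)))
    (h₂ : ∀ v ∈ T.range, Tendsto (fun n => empiricalMeasure x n (T ⁻¹' {v})) atTop
      (𝓝 (μ (T ⁻¹' {v})))) :
    ∀ᶠ n in atTop, wasserstein (empiricalMeasure x n) μ ≤ η + η + η := by
  have := hμ.1
  have hη0 : 0 < η := bot_le.trans_lt hη
  obtain ⟨C, hC⟩ := T.exists_forall_norm_le
  have hTi : ∀ {α : Measure (State d)}, α ∈ finiteMeanMeasures (State d) → Integrable T α :=
    fun hα => have := hα.1
      Integrable.of_bound T.measurable.aestronglyMeasurable C (ae_of_all _ hC)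
  have hTm : ∀ {α : Measure (State d)}, α ∈ finiteMeanMeasures (State d) →
      α.map T ∈ finiteMeanMeasures (State d) := fun hα => have := hα.1
      mem_finiteMeanMeasures_map T.measurable (hTi hα)
  set R := ENNReal.ofReal C with hR
  have hTR : ∀ α : Measure (State d), ∀ᵐ y ∂(α.map T), ‖y‖ₑ ≤ R := by
    intro α
    rw [ae_map_iff T.measurable.aemeasurable (measurableSet_le (by fun_prop) measurable_const)]
    refine ae_of_all _ fun y => ?_
    rw [← ofReal_norm]
    exact ENNReal.ofReal_le_ofReal (hC y)
  obtain ⟨θ, hθ0, hθ1, hθη⟩ : ∃ θ : ℝ≥0∞, 0 < θ ∧ θ ≤ 1 ∧ (R + R) * θ ≤ η := by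
    have hRR : R + R ≠ ∞ := by simp [hR]
    have ht : Tendsto (fun n : ℕ => (R + R) * (n : ℝ≥0∞)⁻¹) atTop (𝓝 ((R + R) * 0)) :=
      ENNReal.Tendsto.const_mul ENNReal.tendsto_inv_nat_nhds_zero (Or.inr hRR)
    rw [mul_zero] at ht
    obtain ⟨n, hn, hn1⟩ := ((ht.eventually (gt_mem_nhds hη0)).and (eventually_ge_atTop 1)).exists
    refine ⟨(n : ℝ≥0∞)⁻¹, by simp, ?_, hn.le⟩
    rw [ENNReal.inv_le_one]
    exact_mod_cast hn1
  have hsmall : ∀ᶠ n in atTop, ∀ v ∈ T.range,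
      (1 - θ) * μ.map T {v} ≤ (empiricalMeasure x n).map T {v} := by
    refine (Finset.eventually_all T.range).2 fun v hv => ?_
    simp only [Measure.map_apply T.measurable (measurableSet_singleton v)]
    -- Null cells are trivial. On the others `(1 - θ) μ` is strictly below `μ`, which leaves room
    -- for the convergence of the weights.
    by_cases h0 : μ (T ⁻¹' {v}) = 0
    · simp [h0]
    · have hlt : (1 - θ) * μ (T ⁻¹' {v}) < μ (T ⁻¹' {v}) := by
        conv_rhs => rw [← one_mul (μ (T ⁻¹' {v}))]
        refine (ENNReal.mul_lt_mul_iff_left h0 (measure_ne_top μ _)).2 ?_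
        exact ENNReal.sub_lt_self ENNReal.one_ne_top one_ne_zero hθ0.ne'
      exact ((h₂ v hv).eventually (lt_mem_nhds hlt)).mono fun n hn => hn.le
  filter_upwards [hsmall, h₁.eventually (gt_mem_nhds hη), eventually_ne_atTop 0] with n h3 h4 hn
  have hemp := empiricalMeasure_mem_finiteMeanMeasures x hn
  have hconull : μ.map T ((T.range : Finset (State d)) : Set (State d))ᶜ = 0 := by
    rw [Measure.map_apply T.measurable (Finset.measurableSet _).compl]
    convert measure_empty (μ := μ)
    ext y
    simp
  have h5 := wasserstein_le_of_smul_le (hTm hemp) (hTm hμ) hθ1 (smul_le_of_singleton hconull h3)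
    (hTR _) (hTR _)
  rw [wasserstein_comm] at h5
  have h6 := wasserstein_map_le hμ T.measurable (hTi hμ)
  rw [wasserstein_comm] at h6
  calc wasserstein (empiricalMeasure x n) μ
      ≤ wasserstein (empiricalMeasure x n) (μ.map T) + wasserstein (μ.map T) μ :=
        wasserstein_triangle _ _ _
    _ ≤ wasserstein (empiricalMeasure x n) ((empiricalMeasure x n).map T) +
          wasserstein ((empiricalMeasure x n).map T) (μ.map T) + wasserstein (μ.map T) μ := by
        gcongr
        exact wasserstein_triangle _ _ _
    _ ≤ η + η + η := by
        gcongr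
        · exact (wasserstein_map_le hemp T.measurable (hTi hemp)).trans h4.le
        · exact h5.trans hθη
        · exact h6.trans hη.le

section Probability

variable {Ω : Type*} [MeasurableSpace Ω] {Pr : Measure Ω} {μ : Measure (State d)}
  {X : ℕ → Ω → State d}

theorem ae_tendsto_lintegral_empiricalMeasure
    (hX_meas : ∀ i, Measurable (X i)) (hX_law : ∀ i, Pr.map (X i) = μ) (hX_indep : iIndepFun X Pr)
    {f : State d → ℝ} (hf : Measurable f) (hf0 : ∀ y, 0 ≤ f y) (hfi : Integrable f μ) :
    ∀ᵐ ω ∂Pr, Tendsto (fun n => ∫⁻ y, ENNReal.ofReal (f y) ∂(empiricalMeasure (fun i => X i ω) n))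
      atTop (𝓝 (∫⁻ y, ENNReal.ofReal (f y) ∂μ)) := by
  have hid (i : ℕ) : IdentDistrib (X i) (X 0) Pr Pr :=
    ⟨(hX_meas i).aemeasurable, (hX_meas 0).aemeasurable, by rw [hX_law, hX_law]⟩
  have hint : Integrable (f ∘ X 0) Pr := by
    rw [← hX_law 0] at hfi
    exact (integrable_map_measure hf.aestronglyMeasurable (hX_meas 0).aemeasurable).1 hfi
  have hmean : ∫ ω, (f ∘ X 0) ω ∂Pr = ∫ y, f y ∂μ := by
    rw [← hX_law 0, integral_map (hX_meas 0).aemeasurable hf.aestronglyMeasurable]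
    rfl
  have := strong_law_ae (fun i => f ∘ X i) hint
    (fun i j hij => (hX_indep.indepFun hij).comp hf hf) fun i => (hid i).comp hf
  filter_upwards [this] with ω hω
  rw [hmean] at hω
  rw [← ofReal_integral_eq_lintegral_ofReal hfi (ae_of_all _ hf0)]
  refine (ENNReal.tendsto_ofReal hω).congr' ?_
  filter_upwards [eventually_ne_atTop 0] with n hn
  have hn' : (0 : ℝ) < n := by exact_mod_cast Nat.pos_of_ne_zero hn
  simp only [Function.comp_apply]
  rw [lintegral_empiricalMeasure, smul_eq_mul, ENNReal.ofReal_mul (by positivity),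
    ENNReal.ofReal_inv_of_pos hn', ENNReal.ofReal_natCast,
    ENNReal.ofReal_sum_of_nonneg fun i _ => hf0 _]

/-- Almost sure convergence of the empirical measures in the Wasserstein distance. -/
theorem ae_tendsto_wasserstein_empiricalMeasure (hμ : μ ∈ finiteMeanMeasures (State d))
    (hX_meas : ∀ i, Measurable (X i)) (hX_law : ∀ i, Pr.map (X i) = μ)
    (hX_indep : iIndepFun X Pr) :
    ∀ᵐ ω ∂Pr, Tendsto (fun n => wasserstein (empiricalMeasure (fun i => X i ω) n) μ) atTop
      (𝓝 0) := by
  have := hμ.1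
  have happ := SimpleFunc.tendsto_approxOn_range_L1_enorm (μ := μ)
    (f := fun y : State d => y) measurable_id hμ.2
  set A := SimpleFunc.approxOn (fun y : State d => y) measurable_id
    (Set.range (fun y : State d => y) ∪ {0}) 0 (by simp) with hA
  -- Countably many levels `j`, each with finitely many cells: the strong law applies to all of them
  -- off a single null set.
  have hall : ∀ j : ℕ, ∀ᵐ ω ∂Pr,
      Tendsto (fun n => ∫⁻ y, ‖y - A j y‖ₑ ∂(empiricalMeasure (fun i => X i ω) n)) atTop
        (𝓝 (∫⁻ y, ‖y - A j y‖ₑ ∂μ)) ∧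
      ∀ v ∈ (A j).range, Tendsto (fun n => empiricalMeasure (fun i => X i ω) n (A j ⁻¹' {v})) atTop
        (𝓝 (μ (A j ⁻¹' {v}))) := by
    intro j
    have hAm := (A j).measurable
    obtain ⟨C, hC⟩ := (A j).exists_forall_norm_le
    have hAi : Integrable (A j) μ :=
      Integrable.of_bound hAm.aestronglyMeasurable C (ae_of_all _ hC)
    have h1 := ae_tendsto_lintegral_empiricalMeasure hX_meas hX_law hX_indep
      (f := fun y => ‖y - A j y‖) (by fun_prop) (fun _ => norm_nonneg _) (hμ.2.sub hAi).norm
    have h2 : ∀ v ∈ (A j).range, ∀ᵐ ω ∂Pr,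
        Tendsto (fun n => empiricalMeasure (fun i => X i ω) n (A j ⁻¹' {v})) atTop
          (𝓝 (μ (A j ⁻¹' {v}))) := by
      intro v _
      have hms : MeasurableSet (A j ⁻¹' {v}) := (A j).measurableSet_fiber v
      have h3 := ae_tendsto_lintegral_empiricalMeasure hX_meas hX_law hX_indep
        (f := (A j ⁻¹' {v}).indicator fun _ => (1 : ℝ)) (measurable_const.indicator hms)
        (fun y => Set.indicator_nonneg (fun _ _ => zero_le_one) y)
        ((integrable_const 1).indicator hms)
      have h4 : (fun y => ENNReal.ofReal ((A j ⁻¹' {v}).indicator (fun _ => (1 : ℝ)) y)) =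
          (A j ⁻¹' {v}).indicator 1 := by
        funext y
        by_cases hy : y ∈ A j ⁻¹' {v}
        · rw [Set.indicator_of_mem hy, Set.indicator_of_mem hy]; simp
        · rw [Set.indicator_of_notMem hy, Set.indicator_of_notMem hy]; simp
      simpa only [h4, lintegral_indicator_one hms] using h3
    have h2' := (Finset.eventually_all (l := ae Pr) (A j).range).2 h2
    filter_upwards [h1, h2'] with ω h1 h2
    refine ⟨?_, h2⟩
    simpa only [ofReal_norm] using h1
  filter_upwards [ae_all_iff.2 hall] with ω hω
  rw [ENNReal.tendsto_nhds_zero]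
  intro ε hε
  obtain ⟨η, hη0, hη⟩ : ∃ η : ℝ≥0∞, 0 < η ∧ η + η + η ≤ ε := by
    refine ⟨ε / 3, ENNReal.div_pos hε.ne' (by simp), le_of_eq (ENNReal.add_thirds ε)⟩
  obtain ⟨j, hj⟩ := (happ.eventually (gt_mem_nhds hη0)).exists
  simp only [enorm_sub_rev] at hj
  refine (eventually_wasserstein_empiricalMeasure_le hμ (A j) (η := η) ?_ (hω j).1
    (hω j).2).mono fun n hn => hn.trans hη
  simpa only [enorm_sub_rev] using hj

theorem wasserstein_empiricalMeasure_le (x y : ℕ → State d) {n : ℕ} (hn : n ≠ 0) {r : ℝ≥0∞}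
    (hr : ∀ i < n, ‖x i - y i‖ₑ ≤ r) :
    wasserstein (empiricalMeasure x n) (empiricalMeasure y n) ≤ r := by
  have hn' : (n : ℝ≥0∞) ≠ 0 := by exact_mod_cast hn
  have hmap (f : State d × State d → State d) (hf : Measurable f) :
      ((n : ℝ≥0∞)⁻¹ • ∑ i ∈ Finset.range n, Measure.dirac (x i, y i)).map f =
        empiricalMeasure (fun i => f (x i, y i)) n := by
    refine Measure.ext_of_lintegral _ fun g hg => ?_
    rw [lintegral_map hg hf, lintegral_empiricalMeasure, lintegral_smul_measure,
      lintegral_finsetSum_measure]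
    simp [lintegral_dirac]
  refine (wasserstein_le_of_coupling (empiricalMeasure_mem_finiteMeanMeasures x hn)
    (empiricalMeasure_mem_finiteMeanMeasures y hn) (hmap _ measurable_fst)
    (hmap _ measurable_snd)).trans ?_
  rw [lintegral_smul_measure, lintegral_finsetSum_measure]
  simp only [lintegral_dirac, smul_eq_mul]
  calc (n : ℝ≥0∞)⁻¹ * ∑ i ∈ Finset.range n, ‖x i - y i‖ₑ
      ≤ (n : ℝ≥0∞)⁻¹ * ∑ i ∈ Finset.range n, r := by
        gcongr with i hi
        exact hr i (Finset.mem_range.1 hi)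
    _ = r := by
        rw [Finset.sum_const, Finset.card_range, nsmul_eq_mul, ← mul_assoc,
          ENNReal.inv_mul_cancel hn' (ENNReal.natCast_ne_top n), one_mul]

/-- Coupling the `i`-th atoms of two samples makes the distance 1-Lipschitz in the sample points.
Continuity supplies the measurability in `ω` that exchanging sum and expectation in (b) requires. -/
theorem continuous_wasserstein_empiricalMeasure {n : ℕ} (hn : n ≠ 0) (μ : Measure (State d)) :
    Continuous fun z : Fin n → State d =>
      wasserstein (empiricalMeasure (fun i => if h : i < n then z ⟨i, h⟩ else 0) n) μ := by
  refine continuous_of_le_add_edist 1 ENNReal.one_ne_top fun z w => ?_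
  rw [one_mul, add_comm]
  refine (wasserstein_triangle _ (empiricalMeasure
    (fun i => if h : i < n then w ⟨i, h⟩ else 0) n) _).trans ?_
  refine add_le_add_left (wasserstein_empiricalMeasure_le _ _ hn fun i hi => ?_) _
  simp only [hi, dif_pos]
  rw [← edist_eq_enorm_sub]
  exact edist_le_pi_edist z w ⟨i, hi⟩

theorem measurable_wasserstein_empiricalMeasure (hX_meas : ∀ i, Measurable (X i)) {n : ℕ}
    (hn : n ≠ 0) (μ : Measure (State d)) :
    Measurable fun ω => wasserstein (empiricalMeasure (fun i => X i ω) n) μ := by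
  have hm : Measurable fun ω (i : Fin n) => X i ω := measurable_pi_lambda _ fun i => hX_meas i
  have h := (continuous_wasserstein_empiricalMeasure hn μ).measurable.comp hm
  have heq (ω : Ω) : empiricalMeasure (fun i => X i ω) n =
      empiricalMeasure (fun i => if h : i < n then X (⟨i, h⟩ : Fin n) ω else 0) n := by
    unfold empiricalMeasure
    refine congrArg _ (Finset.sum_congr rfl fun i hi => ?_)
    simp [Finset.mem_range.1 hi]
  simp only [heq]
  exact h

end Probability

/-! ### Limits of the relaxed values -/

/-- Two-sided stability estimate around a vector of marginals with real value function `p`. -/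
theorem relaxedMOT_mem_Icc {c : PathSpace N d → ℝ} {L : ℝ≥0} (hc : LipschitzWith L c)
    {μ ν : Fin N → Measure (State d)} {p : ℝ → ℝ} (hp : ∀ ε, 0 ≤ ε → relaxedMOT c ε μ = p ε)
    {ε δ : ℝ} (hδε : δ ≤ ε) (hδ : 0 ≤ δ) (hW : wassersteinSum ν μ < ENNReal.ofReal δ) :
    ((p (ε - δ) - L * δ : ℝ) : EReal) ≤ relaxedMOT c ε ν ∧
      relaxedMOT c ε ν ≤ ((p (ε + δ) + L * δ : ℝ) : EReal) := by
  constructor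
  · have h := relaxedMOT_le_of_wassersteinSum_lt hc (ε - δ) (wassersteinSum_comm ν μ ▸ hW)
    rw [hp _ (sub_nonneg.2 hδε), sub_add_cancel] at h
    rw [EReal.coe_sub]
    exact EReal.sub_le_of_le_add h
  · have h := relaxedMOT_le_of_wassersteinSum_lt hc ε hW
    rwa [hp _ (by linarith), ← EReal.coe_add] at h

theorem tendsto_relaxedMOT_of_tendsto_wassersteinSum {c : PathSpace N d → ℝ} {L : ℝ≥0}
    (hc : LipschitzWith L c) {μ : Fin N → Measure (State d)} {p : ℝ → ℝ}
    (hp : ∀ ε, 0 ≤ ε → relaxedMOT c ε μ = p ε) {ε : ℝ} (hε : 0 < ε) {ι : Type*} {l : Filter ι}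
    {ν : ι → Fin N → Measure (State d)} (hν : Tendsto (fun n => wassersteinSum (ν n) μ) l (𝓝 0)) :
    Tendsto (fun n => relaxedMOT c ε (ν n)) l (𝓝 (p ε : EReal)) := by
  -- Concavity gives continuity in the open half-line only, which is why `ε > 0` is fixed here and
  -- the point `0` is treated separately.
  have hcont : ContinuousAt p ε :=
    (((concaveOn_relaxedMOT hc hp).subset Set.Ioi_subset_Ici_self (convex_Ioi 0)).continuousOn
      isOpen_Ioi).continuousAt (Ioi_mem_nhds hε)
  have hlow : Tendsto (fun δ => ((p (ε - δ) - L * δ : ℝ) : EReal)) (𝓝[>] 0) (𝓝 (p ε)) := by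
    refine (continuous_coe_real_ereal.tendsto _).comp (tendsto_nhdsWithin_of_tendsto_nhds ?_)
    have h1 : Tendsto (fun δ : ℝ => p (ε - δ)) (𝓝 0) (𝓝 (p ε)) :=
      hcont.tendsto.comp (by simpa using tendsto_const_nhds.sub (tendsto_id (α := ℝ) (x := 𝓝 0)))
    simpa using h1.sub ((tendsto_id (α := ℝ) (x := 𝓝 0)).const_mul (L : ℝ))
  have hup : Tendsto (fun δ => ((p (ε + δ) + L * δ : ℝ) : EReal)) (𝓝[>] 0) (𝓝 (p ε)) := by
    refine (continuous_coe_real_ereal.tendsto _).comp (tendsto_nhdsWithin_of_tendsto_nhds ?_)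
    have h1 : Tendsto (fun δ : ℝ => p (ε + δ)) (𝓝 0) (𝓝 (p ε)) :=
      hcont.tendsto.comp (by simpa using tendsto_const_nhds.add (tendsto_id (α := ℝ) (x := 𝓝 0)))
    simpa using h1.add ((tendsto_id (α := ℝ) (x := 𝓝 0)).const_mul (L : ℝ))
  have hsmall : ∀ᶠ δ in 𝓝[>] (0 : ℝ), 0 < δ ∧ δ ≤ ε := by
    filter_upwards [Ioc_mem_nhdsGT hε] with δ hδ using hδ
  refine tendsto_order.2 ⟨fun a ha => ?_, fun a ha => ?_⟩
  · obtain ⟨δ, h1, h2, h3⟩ := ((hlow.eventually (lt_mem_nhds ha)).and hsmall).exists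
    filter_upwards [hν.eventually (gt_mem_nhds (ENNReal.ofReal_pos.2 h2))] with n hn
    exact h1.trans_le (relaxedMOT_mem_Icc hc hp h3 h2.le hn).1
  · obtain ⟨δ, h1, h2, h3⟩ := ((hup.eventually (gt_mem_nhds ha)).and hsmall).exists
    filter_upwards [hν.eventually (gt_mem_nhds (ENNReal.ofReal_pos.2 h2))] with n hn
    exact (relaxedMOT_mem_Icc hc hp h3 h2.le hn).2.trans_lt h1

/-- Monotonicity of `p` gives the lower bound; the upper one is the compactness statement
`exists_relaxedMOT_le`. -/
theorem tendsto_value_zero {c : PathSpace N d → ℝ} {L : ℝ≥0} (hc : LipschitzWith L c)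
    {μ : Fin N → Measure (State d)} {p : ℝ → ℝ} (hp : ∀ ε, 0 ≤ ε → relaxedMOT c ε μ = p ε)
    {ι : Type*} {l : Filter ι} {ε : ι → ℝ} (hε_pos : ∀ m, 0 < ε m) (hε : Tendsto ε l (𝓝 0)) :
    Tendsto (fun m => p (ε m)) l (𝓝 (p 0)) := by
  have hmono : ∀ {s t : ℝ}, 0 ≤ s → s ≤ t → p s ≤ p t := by
    intro s t hs hst
    have h := relaxedMOT_mono c μ hst
    simp only [hp s hs, hp t (hs.trans hst)] at h
    exact EReal.coe_le_coe_iff.1 h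
  refine tendsto_order.2 ⟨fun a ha => ?_, fun a ha => ?_⟩
  · exact Eventually.of_forall fun m => ha.trans_le (hmono le_rfl (hε_pos m).le)
  · obtain ⟨r, hr, hra⟩ := exists_between ha
    obtain ⟨η, hη, hle⟩ := exists_relaxedMOT_le hc (μ := μ) (r := r)
      (by rw [hp 0 le_rfl, EReal.coe_lt_coe_iff]; exact hr)
    rw [hp η (le_of_lt hη), EReal.coe_le_coe_iff] at hle
    filter_upwards [hε.eventually (gt_mem_nhds hη)] with m hm
    exact ((hmono (hε_pos m).le hm.le).trans hle).trans_lt hra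

end MOT

theorem mainTheorem10 {N d : ℕ} {Ω : Type*} [MeasurableSpace Ω]
    (Pr : Measure Ω) [IsProbabilityMeasure Pr]
    (μ : Fin N → Measure (MOT.State d)) (hμ : μ ∈ MOT.admissibleMarginals N d 0)
    (c : MOT.PathSpace N d → ℝ) (hc : ∃ L : ℝ≥0, LipschitzWith L c)
    (X : Fin N → ℕ → Ω → MOT.State d)
    (hX_meas : ∀ k i, Measurable (X k i))
    (hX_law : ∀ k i, Pr.map (X k i) = μ k)
    (hX_indep : ∀ k, iIndepFun (X k) Pr)
    (ε : ℕ → ℝ) (hε_pos : ∀ m, 0 < ε m) (hε_lim : Tendsto ε atTop (𝓝 0)) :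
    (∀ᵐ ω ∂Pr, ∃ ℓ : ℕ → EReal,
      (∀ m, Tendsto
        (fun n : ℕ => MOT.relaxedMOT c (ε m)
          (fun k => MOT.empiricalMeasure (fun i => X k i ω) n)) atTop (𝓝 (ℓ m))) ∧
      Tendsto ℓ atTop (𝓝 (MOT.relaxedMOT c 0 μ))) ∧
    (∀ nhat : ℕ → ℕ, (∀ m, 1 ≤ nhat m) → StrictMono nhat →
      ∑' m, (∫⁻ ω, MOT.wassersteinSum
        (fun k => MOT.empiricalMeasure (fun i => X k i ω) (nhat m)) μ ∂Pr)
          / ENNReal.ofReal (ε m) < ∞ →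
      ∀ᵐ ω ∂Pr, Tendsto
        (fun m : ℕ => MOT.relaxedMOT c (ε m)
          (fun k => MOT.empiricalMeasure (fun i => X k i ω) (nhat m)))
        atTop (𝓝 (MOT.relaxedMOT c 0 μ))) := by
  obtain ⟨L, hc⟩ := hc
  obtain ⟨p, hp⟩ := MOT.exists_relaxedMOT_eq_coe hc hμ
  rw [hp 0 le_rfl]
  refine ⟨?_, fun nhat hn _ hsum => ?_⟩
  · filter_upwards [ae_all_iff.2 fun k => MOT.ae_tendsto_wasserstein_empiricalMeasure (hμ.1 k)
      (hX_meas k) (hX_law k) (hX_indep k)] with ω hω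
    refine ⟨fun m => p (ε m), fun m => ?_, ?_⟩
    · refine MOT.tendsto_relaxedMOT_of_tendsto_wassersteinSum hc hp (hε_pos m) ?_
      simpa [MOT.wassersteinSum] using tendsto_finsetSum Finset.univ fun k _ => hω k
    · exact (continuous_coe_real_ereal.tendsto _).comp
        (MOT.tendsto_value_zero hc hp hε_pos hε_lim)
  · have hmeas (m : ℕ) : Measurable fun ω => MOT.wassersteinSum
        (fun k => MOT.empiricalMeasure (fun i => X k i ω) (nhat m)) μ :=
      Finset.measurable_fun_sum _ fun k _ => MOT.measurable_wasserstein_empiricalMeasure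
        (hX_meas k) (Nat.one_le_iff_ne_zero.1 (hn m)) (μ k)
    have hε0 (m : ℕ) : ENNReal.ofReal (ε m) ≠ 0 := (ENNReal.ofReal_pos.2 (hε_pos m)).ne'
    -- By Tonelli the random series of ratios has finite expectation, hence converges almost surely
    -- and its terms tend to zero; this takes the place of a Borel–Cantelli argument.
    have hfin : ∫⁻ ω, ∑' m, MOT.wassersteinSum
        (fun k => MOT.empiricalMeasure (fun i => X k i ω) (nhat m)) μ / ENNReal.ofReal (ε m) ∂Pr
        ≠ ∞ := by
      rw [lintegral_tsum fun m => ((hmeas m).div_const _).aemeasurable]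
      refine ne_of_lt (lt_of_eq_of_lt (tsum_congr fun m => ?_) hsum)
      simp only [div_eq_mul_inv]
      rw [lintegral_mul_const _ (hmeas m)]
    filter_upwards [ae_lt_top (Measurable.tsum fun m => (hmeas m).div_const _) hfin]
      with ω hω
    have hlt : ∀ᶠ m in atTop, MOT.wassersteinSum
        (fun k => MOT.empiricalMeasure (fun i => X k i ω) (nhat m)) μ < ENNReal.ofReal (ε m) := by
      filter_upwards [(ENNReal.tendsto_atTop_zero_of_tsum_ne_top hω.ne).eventually
        (gt_mem_nhds one_pos)] with m hm
      rwa [ENNReal.div_lt_iff (Or.inl (hε0 m)) (Or.inl ENNReal.ofReal_ne_top), one_mul] at hm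
    have hLε : Tendsto (fun m => (L : ℝ) * ε m) atTop (𝓝 0) := by simpa using hε_lim.const_mul (L : ℝ)
    -- Taking `δ = ε m` in the sandwich turns the lower relaxation `ε - δ` into exactly `0` and the
    -- upper one into `2 ε m`.
    have hup := MOT.tendsto_value_zero hc hp (ε := fun m => ε m + ε m)
      (fun m => add_pos (hε_pos m) (hε_pos m)) (by simpa using hε_lim.add hε_lim)
    refine tendsto_of_tendsto_of_tendsto_of_le_of_le'
      (g := fun m => ((p 0 - L * ε m : ℝ) : EReal))
      (h := fun m => ((p (ε m + ε m) + L * ε m : ℝ) : EReal)) ?_ ?_ ?_ ?_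
    · exact (continuous_coe_real_ereal.tendsto _).comp
        (by simpa using tendsto_const_nhds.sub hLε)
    · exact (continuous_coe_real_ereal.tendsto _).comp (by simpa using hup.add hLε)
    · filter_upwards [hlt] with m hm
      simpa using (MOT.relaxedMOT_mem_Icc hc hp le_rfl (hε_pos m).le hm).1
    · filter_upwards [hlt] with m hm
      exact (MOT.relaxedMOT_mem_Icc hc hp le_rfl (hε_pos m).le hm).2
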